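/- Let $s_0>0$ and $a_m=m^{s_0-1}$ for $m\ge 1$. For $|z|<1$ let $Q_n(z)$ be the coefficients defined, for $|q|<1$, by \[1+\sum_{n=1}^\infty Q_n(z)q^n=\prod_{m=1}^\infty\frac{1}{(1-zq^m)^{a_m}},\] with principal powers. Let $\zeta$ be the Riemann zeta function, $\mathrm{Li}_s(x)=\sum_{j\ge 1}x^j/j^s$ the polylogarithm, and for $0<x<1$ put \[L_{1,1}(x)=\left(\Gamma(s_0+1)\,\mathrm{Li}_{s_0+1}(x)\right)^{1/(s_0+1)},\] \[M_n(x)=(1-x)^{-\zeta(1-s_0)}\sqrt{\frac{L_{1,1}(x)}{2\pi(s_0+1)\,n^{\frac{s_0+2}{s_0+1}}}}\;\exp\left(\frac{s_0+1}{s_0}\,n^{\frac{s_0}{s_0+1}}L_{1,1}(x)\right).\] Let $X\subset(0,1)$ be compact. Then $Q_n(x)\sim M_n(x)$ as $n\to\infty$, uniformly for $x\in X$; that is, $Q_n(x)/M_n(x)\to 1$ uniformly on $X$. Moreover, for every $\sigma_0\in(-1,0)$ the relative error is $O(n^{-\mu})$ with \[\mu=\min\left(\frac{-\sigma_0}{s_0+1},\frac{s_0}{2s_0+2}\right):\]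 there is a constant $C$, depending only on $s_0$, $\sigma_0$ and $X$, such that $|Q_n(x)/M_n(x)-1|\le C n^{-\mu}$ for all sufficiently large $n$ (uniformly in $x$) and all $x\in X$. -/

import Mathlib

/-- The generating function `P(z, q) = ∏_{m ≥ 1} 1 / (1 - z q ^ m) ^ (a m)`, with principal powers
(for `‖z‖ < 1` and `‖q‖ < 1` every base `1 - z q ^ m` lies in the right half plane). -/
noncomputable def genProduct (a : ℕ → ℝ) (z q : ℂ) : ℂ :=
  ∏' m : ℕ, 1 / (1 - z * q ^ (m + 1)) ^ ((a (m + 1) : ℝ) : ℂ)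

/-- `Q_n(z)`: the coefficient of `q ^ n` in the expansion of `q ↦ P(z, q)` at `q = 0`. -/
noncomputable def genCoeff (a : ℕ → ℝ) (n : ℕ) (z : ℂ) : ℂ :=
  iteratedDeriv n (fun q : ℂ => genProduct a z q) 0 / (n.factorial : ℂ)

/-- The power function sequence `a_m = m ^ (s₀ - 1)`. -/
noncomputable def powerSeq (s₀ : ℝ) (m : ℕ) : ℝ := (m : ℝ) ^ (s₀ - 1)

/-- The polylogarithm `Li_s(x) = ∑_{j ≥ 1} x ^ j / j ^ s`, for real `s` and `-1 < x < 1`. -/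
noncomputable def polylog (s x : ℝ) : ℝ :=
  ∑' j : ℕ, x ^ (j + 1) / ((j + 1 : ℕ) : ℝ) ^ s

/-- `L_{1,1}(x) = (Γ(s₀ + 1) Li_{s₀ + 1}(x)) ^ (1 / (s₀ + 1))`. -/
noncomputable def phaseL (s₀ x : ℝ) : ℝ :=
  (Real.Gamma (s₀ + 1) * polylog (s₀ + 1) x) ^ (1 / (s₀ + 1))

/-- The approximation
`(1 - x) ^ (-ζ(1 - s₀)) * √(L / (2π (s₀ + 1) n ^ ((s₀ + 2) / (s₀ + 1))))
  * exp ((s₀ + 1) / s₀ * n ^ (s₀ / (s₀ + 1)) * L)` with `L = L_{1,1}(x)`. -/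
noncomputable def mainTerm (s₀ : ℝ) (n : ℕ) (x : ℝ) : ℂ :=
  (1 - (x : ℂ)) ^ (-riemannZeta (1 - (s₀ : ℂ))) *
    ((Real.sqrt (phaseL s₀ x /
        (2 * Real.pi * (s₀ + 1) * (n : ℝ) ^ ((s₀ + 2) / (s₀ + 1)))) *
      Real.exp ((s₀ + 1) / s₀ * (n : ℝ) ^ (s₀ / (s₀ + 1)) * phaseL s₀ x) : ℝ) : ℂ)

open Complex Filter Topology MeasureTheory Set

/-! The proof is the circle method with a saddle point, uniform in `x`. Write `s` for `s₀`, `D(t) =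
Σ m ^ (s - 1) e ^ (-m t)` and `q = e ^ (-τ)`. Expanding the logarithms gives `log P(x, q) = Σ_k (x ^
k / k) D(k τ)`, so everything rests on `D` near `0`.

In the sector `|Im t| ≤ Re t` one has `D(t) = Γ(s) t ^ (-s) + ζ(1 - s) + O(|t|)`
(`norm_powExpSum_sub_le`). This comes from Poisson summation rather than a Mellin contour shift: the
frequency `n` contributes `Γ(s) (t + 2 π i n) ^ (-s)`, the frequency `0` is the singular term, and
the others are Lipschitz down to `t = 0`. To converge for every `Re s > 0`, the formula is applied
to differences `D(t) - D(t')`. The lost constant is found for `Re s > 1` from the functional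
equation of `ζ` and continued analytically in `s` (`powExpConst_eq_riemannZeta`). Summation over `k`
yields `log P = Γ(s) Li_{s+1}(x) τ ^ (-s) - ζ(1 - s) log (1 - x) + O(|τ|)`
(`norm_logGenProduct_sub_le`).

Cauchy's formula is used on `|q| = e ^ (-σ)` with `σ = L n ^ (-1 / (s + 1))`, the critical point of
`n τ + Γ(s) Li_{s+1}(x) τ ^ (-s)`; the large parameter is `l = n σ`. For `|θ| ≤ δ σ` the integrand
is compared with a Gaussian (`exists_norm_integral_sub_gaussian_le`). For the remaining `θ`,
cancellation in a geometric sum makes `Re log P` drop by a multiple of `x σ ^ (-s)`, hence of `l`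
when `x` stays below some `b < 1` (`re_logGenProduct_le`). The relative error is `O(l ^ (-1/2) + σ)`
up to an exponentially small term, which gives the two exponents `s / (2 s + 2)` and `1 / (s + 1)`;
the latter exceeds `-σ₀ / (s + 1)`. -/

/-! ### Laplace transform of a power -/

theorem integrableOn_cpow_mul_exp_neg_mul {s t : ℂ} (hs : 0 < s.re) (ht : 0 < t.re) :
    IntegrableOn (fun u : ℝ => (u : ℂ) ^ (s - 1) * exp (-(t * u))) (Ioi 0) := by
  have h := integrableOn_rpow_mul_exp_neg_mul_rpow (p := 1) (s := s.re - 1) (b := t.re)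
    (by linarith) one_pos ht
  refine Integrable.mono' h ?_ ?_
  · refine ContinuousOn.aestronglyMeasurable (fun u hu => ?_) measurableSet_Ioi
    refine ContinuousAt.continuousWithinAt (ContinuousAt.mul ?_ (by fun_prop))
    exact ContinuousAt.cpow (by fun_prop) continuousAt_const (ofReal_mem_slitPlane.2 hu)
  · refine (ae_restrict_iff' measurableSet_Ioi).2 (Eventually.of_forall fun u hu => ?_)
    rw [norm_mul, norm_cpow_eq_rpow_re_of_pos hu, norm_exp]
    simp

theorem differentiableOn_laplace_cpow {s : ℂ} (hs : 0 < s.re) :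
    DifferentiableOn ℂ (fun t : ℂ => ∫ u in Ioi (0 : ℝ), (u : ℂ) ^ (s - 1) * exp (-(t * u)))
      {t | 0 < t.re} := by
  intro t₀ ht₀
  have ht₀' : 0 < t₀.re := ht₀
  set ε := t₀.re / 2 with hε
  have hε0 : 0 < ε := by positivity
  have hnhds : {t : ℂ | ε < t.re} ∈ 𝓝 t₀ :=
    (isOpen_lt continuous_const continuous_re).mem_nhds (by simp only [mem_ofPred_eq]; linarith)
  -- Differentiating in `t` brings down a factor `u`, so the majorant is the same integrand with `s
  -- + 1`.
  have hb := integrableOn_cpow_mul_exp_neg_mul (s := s + 1) (t := ε) (by simp; linarith)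
    (by simpa using hε0)
  have := (hasDerivAt_integral_of_dominated_loc_of_deriv_le (μ := volume.restrict (Ioi (0 : ℝ)))
    (F := fun (t : ℂ) (u : ℝ) => (u : ℂ) ^ (s - 1) * exp (-(t * u)))
    (F' := fun (t : ℂ) (u : ℝ) => (u : ℂ) ^ (s - 1) * (exp (-(t * u)) * (-u)))
    (bound := fun u : ℝ => ‖(u : ℂ) ^ (s + 1 - 1) * exp (-((ε : ℂ) * u))‖)
    hnhds ?_ ?_ ?_ ?_ hb.norm ?_).2
  · exact this.differentiableAt.differentiableWithinAt
  · filter_upwards [hnhds] with t ht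
    exact (integrableOn_cpow_mul_exp_neg_mul hs (hε0.trans ht)).aestronglyMeasurable
  · exact integrableOn_cpow_mul_exp_neg_mul hs ht₀
  · have h := (integrableOn_cpow_mul_exp_neg_mul hs ht₀).aestronglyMeasurable.mul
      (f := fun u : ℝ => (u : ℂ) ^ (s - 1) * exp (-(t₀ * u))) (g := fun u : ℝ => (-u : ℂ))
      (by fun_prop)
    refine h.congr (Eventually.of_forall fun u => ?_)
    simp only [Pi.mul_apply, mul_assoc]
  · refine (ae_restrict_iff' measurableSet_Ioi).2 (Eventually.of_forall fun u hu t ht => ?_)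
    have hu : 0 < u := hu
    rw [norm_mul, norm_mul, norm_mul, norm_cpow_eq_rpow_re_of_pos hu, norm_exp,
      norm_cpow_eq_rpow_re_of_pos hu, norm_exp, norm_neg, norm_real, Real.norm_of_nonneg hu.le]
    have e1 : u ^ (s + 1 - 1).re = u ^ (s - 1).re * u := by
      rw [← Real.rpow_add_one hu.ne']; congr 1; simp
    rw [e1, mul_assoc, mul_comm u]
    have : t.re > ε := ht
    have e2 : (-(t * u)).re ≤ (-((ε : ℂ) * u)).re := by simp; nlinarith
    exact mul_le_mul_of_nonneg_left (mul_le_mul_of_nonneg_right (Real.exp_le_exp.2 e2) hu.le)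
      (by positivity)
  · refine Eventually.of_forall fun u t ht => ?_
    have : HasDerivAt (fun t : ℂ => -(t * u)) (-u : ℂ) t := by
      simpa using ((hasDerivAt_id t).mul_const (u : ℂ)).fun_neg
    exact (this.cexp).const_mul _

/-- The Laplace transform of `u ^ (s - 1)` is `Γ(s) t ^ (-s)`. -/
theorem laplace_cpow {s t : ℂ} (hs : 0 < s.re) (ht : 0 < t.re) :
    ∫ u in Ioi (0 : ℝ), (u : ℂ) ^ (s - 1) * exp (-(t * u)) = Gamma s * t ^ (-s) := by
  have hopen : IsOpen {t : ℂ | 0 < t.re} := isOpen_lt continuous_const continuous_re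
  have h1 := (differentiableOn_laplace_cpow hs).analyticOnNhd hopen
  have h2 : AnalyticOnNhd ℂ (fun t : ℂ => Gamma s * t ^ (-s)) {t | 0 < t.re} := by
    refine DifferentiableOn.analyticOnNhd (fun t ht => ?_) hopen
    have : t ∈ slitPlane := Or.inl ht
    exact (((hasDerivAt_id t).cpow_const this).differentiableAt.const_mul _).differentiableWithinAt
  refine h1.eqOn_of_preconnected_of_mem_closure h2
    (convex_halfSpace_re_gt 0).isPreconnected (z₀ := 1) (by simp) ?_ ht
  -- The formula is known for real `t`; real points accumulating at `1` suffice for the identity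
  -- theorem.
  refine mem_closure_of_tendsto (f := fun n : ℕ => ((1 + 1 / ((n : ℝ) + 1) : ℝ) : ℂ)) (b := atTop)
    ?_ (Eventually.of_forall fun n => ⟨?_, ?_⟩)
  · have := (tendsto_one_div_add_atTop_nhds_zero_nat (𝕜 := ℝ)).const_add 1
    simpa [Function.comp_def] using (continuous_ofReal.tendsto _).comp this
  · have hr : (0 : ℝ) < 1 + 1 / ((n : ℝ) + 1) := by positivity
    simp only [mem_ofPred_eq]
    rw [integral_cpow_mul_exp_neg_mul_Ioi hs hr, mul_comm, one_div, cpow_neg, inv_cpow]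
    rw [arg_ofReal_of_nonneg hr.le]; exact Real.pi_pos.ne
  · have hr : (0 : ℝ) < 1 / ((n : ℝ) + 1) := by positivity
    simp only [mem_singleton_iff]
    intro h
    rw [← ofReal_one, ofReal_inj] at h
    linarith

/-! ### Poisson terms on a sector -/

/-- The closed sector `|Im t| ≤ Re t`. -/
def sector : Set ℂ := {t | |t.im| ≤ t.re}

theorem convex_sector : Convex ℝ sector := by
  intro x hx y hy a b ha hb _
  have hx' : |x.im| ≤ x.re := hx
  have hy' : |y.im| ≤ y.re := hy
  simp only [sector, mem_ofPred_eq, add_im, real_smul, re_ofReal_mul, im_ofReal_mul, add_re]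
  calc |a * x.im + b * y.im| ≤ |a * x.im| + |b * y.im| := abs_add_le _ _
    _ = a * |x.im| + b * |y.im| := by rw [abs_mul, abs_mul, abs_of_nonneg ha, abs_of_nonneg hb]
    _ ≤ _ := by gcongr

/-- Since `|Im t| ≤ Re t`, both `|Im t + 2 π n|` and `|Im t|` are at most the norm of the shifted
point, so that norm is at least `π |n|`. The bound persists at `t = 0`, which is what allows passing
to the vertex. -/
theorem abs_le_norm_sector_add {t : ℂ} (ht : t ∈ sector) (n : ℤ) :
    |(n : ℝ)| ≤ ‖t + 2 * Real.pi * I * n‖ := by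
  have ht' : |t.im| ≤ t.re := ht
  have h1 := abs_re_le_norm (t + 2 * Real.pi * I * n)
  have h2 := abs_im_le_norm (t + 2 * Real.pi * I * n)
  have e1 : (t + 2 * Real.pi * I * n).re = t.re := by simp
  have e2 : (t + 2 * Real.pi * I * n).im = t.im + 2 * Real.pi * n := by simp
  rw [e1] at h1
  rw [e2] at h2
  have h3 : |2 * Real.pi * (n : ℝ)| ≤ |t.im + 2 * Real.pi * n| + |t.im| := by
    calc _ = |(t.im + 2 * Real.pi * n) - t.im| := by congr 1; ring
      _ ≤ _ := abs_sub _ _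
  rw [abs_mul, abs_of_pos Real.two_pi_pos] at h3
  have h4 := le_abs_self t.re
  have h5 := Real.pi_gt_three
  nlinarith [abs_nonneg (n : ℝ)]

theorem sector_add_mem_slitPlane {t : ℂ} (ht : t ∈ sector) {n : ℤ} (hn : n ≠ 0) :
    t + 2 * Real.pi * I * n ∈ slitPlane := by
  have ht' : |t.im| ≤ t.re := ht
  have e1 : (t + 2 * Real.pi * I * n).re = t.re := by simp
  have e2 : (t + 2 * Real.pi * I * n).im = t.im + 2 * Real.pi * n := by simp
  rw [mem_slitPlane_iff, e1, e2]
  by_cases h : 0 < t.re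
  · exact Or.inl h
  · have h0 : t.im = 0 := abs_eq_zero.1 (le_antisymm (by linarith) (abs_nonneg _))
    right
    rw [h0, zero_add]
    have := Real.pi_pos
    have : (n : ℝ) ≠ 0 := by exact_mod_cast hn
    positivity

theorem norm_cpow_le_of_le_norm {w s : ℂ} {r : ℝ} (hr : 0 < r) (hw : r ≤ ‖w‖) (hs : 0 ≤ s.re) :
    ‖w ^ (-s)‖ ≤ Real.exp (Real.pi * |s.im|) * r ^ (-s.re) := by
  refine (norm_cpow_le _ _).trans ?_
  rw [div_eq_mul_inv, ← Real.exp_neg, mul_comm]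
  simp only [neg_re, neg_im]
  refine mul_le_mul (Real.exp_le_exp.2 ?_) ?_ (by positivity) (by positivity)
  · calc -(w.arg * -s.im) ≤ |-(w.arg * -s.im)| := le_abs_self _
      _ = |w.arg| * |s.im| := by rw [abs_neg, abs_mul, abs_neg]
      _ ≤ _ := by gcongr; exact abs_arg_le_pi _
  · exact Real.rpow_le_rpow_of_nonpos hr hw (by linarith)

/-- The term of index `n` in the Poisson sum for `Σ m ^ (s - 1) (e ^ (-m t) - e ^ (-m t'))`. -/
noncomputable def poissonTerm (s t t' : ℂ) (n : ℤ) : ℂ :=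
  (t + 2 * Real.pi * I * n) ^ (-s) - (t' + 2 * Real.pi * I * n) ^ (-s)

/-- Mean value inequality on the convex sector. Differencing gains one power of `|n|`, so the series
converges for all `Re s > 0` and not only for `Re s > 1`. -/
theorem norm_poissonTerm_le {s t t' : ℂ} (hs : 0 < s.re) (ht : t ∈ sector) (ht' : t' ∈ sector)
    {n : ℤ} (hn : n ≠ 0) :
    ‖poissonTerm s t t' n‖ ≤
      ‖s‖ * Real.exp (Real.pi * |s.im|) * |(n : ℝ)| ^ (-(s.re + 1)) * ‖t - t'‖ := by
  have hn' : 0 < |(n : ℝ)| := by positivity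
  refine convex_sector.norm_image_sub_le_of_norm_hasDerivWithin_le
    (f := fun t : ℂ => (t + 2 * Real.pi * I * n) ^ (-s))
    (f' := fun t : ℂ => -s * (t + 2 * Real.pi * I * n) ^ (-s - 1) * 1) (fun w hw => ?_)
    (fun w hw => ?_) ht' ht
  · exact (((hasDerivAt_id w).add_const _).cpow_const
      (sector_add_mem_slitPlane hw hn)).hasDerivWithinAt
  · have := norm_cpow_le_of_le_norm (s := s + 1) hn' (abs_le_norm_sector_add hw n)
      (by simp; linarith)
    simp only [add_im, one_im, add_zero, add_re, one_re] at this
    rw [mul_one, norm_mul, norm_neg, mul_assoc ‖s‖, ← neg_add']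
    exact mul_le_mul_of_nonneg_left this (norm_nonneg _)

theorem summable_poissonTerm {s t t' : ℂ} (hs : 0 < s.re) (ht : t ∈ sector) (ht' : t' ∈ sector) :
    Summable (poissonTerm s t t') := by
  have h := ((Real.summable_abs_int_rpow (b := s.re + 1) (by linarith)).mul_left
      (‖s‖ * Real.exp (Real.pi * |s.im|))).mul_right ‖t - t'‖
  refine Summable.of_norm_bounded_eventually h ?_
  filter_upwards [(finite_singleton (0 : ℤ)).compl_mem_cofinite] with n hn
  exact norm_poissonTerm_le hs ht ht' hn

/-! ### Poisson summation -/

/-- `u_+ ^ (s - 1) (e ^ (-t u) - e ^ (-t' u))`. -/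
noncomputable def expDiffKernel (s t t' : ℂ) (u : ℝ) : ℂ :=
  if 0 < u then (u : ℂ) ^ (s - 1) * (exp (-(t * u)) - exp (-(t' * u))) else 0

theorem norm_exp_neg_sub_exp_neg_le {a b : ℂ} (ha : 0 ≤ a.re) (hb : 0 ≤ b.re) :
    ‖exp (-a) - exp (-b)‖ ≤ ‖a - b‖ := by
  have := (convex_halfSpace_re_ge 0).norm_image_sub_le_of_norm_hasDerivWithin_le
    (f := fun w : ℂ => exp (-w)) (f' := fun w => exp (-w) * (-1)) (C := 1) (x := b) (y := a)
    (fun w _ => ((hasDerivAt_id w).fun_neg.cexp).hasDerivWithinAt)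
    (fun w hw => ?_) hb ha
  · simpa using this
  · have hw' : 0 ≤ w.re := hw
    rw [norm_mul, norm_exp]
    simpa using hw'

/-- The only delicate point is `u = 0`: the difference of exponentials is `O(u)`, so the kernel is
`O(u ^ Re s)`. A single exponential would not be continuous there when `Re s ≤ 1`. -/
theorem continuous_expDiffKernel {s t t' : ℂ} (hs : 0 < s.re) (ht : 0 < t.re) (ht' : 0 < t'.re) :
    Continuous (expDiffKernel s t t') := by
  have bound : ∀ u : ℝ, 0 ≤ u → ‖expDiffKernel s t t' u‖ ≤ u ^ s.re * ‖t - t'‖ := by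
    intro u hu
    rcases hu.eq_or_lt with rfl | hu
    · simp [expDiffKernel]; positivity
    · have h := norm_exp_neg_sub_exp_neg_le (a := t * u) (b := t' * u) (by simp; positivity)
        (by simp; positivity)
      rw [expDiffKernel, if_pos hu, norm_mul, norm_cpow_eq_rpow_re_of_pos hu]
      rw [← sub_mul, norm_mul, norm_real, Real.norm_of_nonneg hu.le] at h
      calc _ ≤ u ^ (s - 1).re * (‖t - t'‖ * u) := by gcongr
        _ = u ^ ((s - 1).re + 1) * ‖t - t'‖ := by rw [Real.rpow_add_one hu.ne']; ring
        _ = _ := by simp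
  rw [continuous_iff_continuousAt]
  intro u
  rcases lt_trichotomy u 0 with hu | rfl | hu
  · refine ContinuousAt.congr (f := fun _ => (0 : ℂ)) continuousAt_const ?_
    filter_upwards [Iio_mem_nhds hu] with v hv
    rw [expDiffKernel, if_neg (not_lt.2 (le_of_lt hv))]
  · have h0 : expDiffKernel s t t' 0 = 0 := by simp [expDiffKernel]
    rw [ContinuousAt, h0]
    refine squeeze_zero_norm (a := fun u : ℝ => |u| ^ s.re * ‖t - t'‖) (fun u => ?_) ?_
    · rcases le_or_gt 0 u with hu | hu
      · simpa [abs_of_nonneg hu] using bound u hu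
      · rw [expDiffKernel, if_neg (not_lt.2 hu.le), norm_zero]; positivity
    · have : Continuous (fun u : ℝ => |u| ^ s.re * ‖t - t'‖) :=
        (continuous_abs.rpow_const (fun _ => Or.inr hs.le)).mul_const _
      simpa [Real.zero_rpow hs.ne'] using this.tendsto 0
  · have : ContinuousAt
        (fun u : ℝ => (u : ℂ) ^ (s - 1) * (exp (-(t * u)) - exp (-(t' * u)))) u :=
      ContinuousAt.mul (ContinuousAt.cpow (by fun_prop) continuousAt_const
        (ofReal_mem_slitPlane.2 hu)) (by fun_prop)
    refine this.congr ?_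
    filter_upwards [Ioi_mem_nhds hu] with v hv
    rw [expDiffKernel, if_pos (mem_Ioi.1 hv)]

theorem isBigO_expDiffKernel {s t t' : ℂ} (ht : 0 < t.re) (ht' : 0 < t'.re) :
    expDiffKernel s t t' =O[cocompact ℝ] fun u : ℝ => |u| ^ (-2 : ℝ) := by
  rw [cocompact_eq_atBot_atTop]
  refine Asymptotics.IsBigO.sup ?_ ?_
  · refine Asymptotics.IsBigO.of_bound 0 ?_
    filter_upwards [eventually_le_atBot 0] with u hu
    rw [expDiffKernel, if_neg (not_lt.2 hu)]; simp
  · have key : ∀ r : ℂ, 0 < r.re →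
        (fun u : ℝ => (u : ℂ) ^ (s - 1) * exp (-(r * u))) =O[atTop] fun u : ℝ => |u| ^ (-2 : ℝ) := by
      intro r hr
      have h := (isLittleO_exp_neg_mul_rpow_atTop hr (-2 - (s - 1).re)).isBigO
      have h2 := (Asymptotics.isBigO_refl (fun u : ℝ => u ^ (s - 1).re) atTop).mul h
      refine (h2.congr' ?_ ?_ : (fun u : ℝ => ‖(u : ℂ) ^ (s - 1) * exp (-(r * u))‖) =O[atTop] _).of_norm_left
      · filter_upwards [eventually_gt_atTop 0] with u hu
        rw [norm_mul, norm_cpow_eq_rpow_re_of_pos hu, norm_exp]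
        simp
      · filter_upwards [eventually_gt_atTop 0] with u hu
        rw [← Real.rpow_add hu, abs_of_pos hu]; congr 1; ring
    refine ((key t ht).sub (key t' ht')).congr' ?_ EventuallyEq.rfl
    filter_upwards [eventually_gt_atTop 0] with u hu
    rw [expDiffKernel, if_pos hu, mul_sub]

theorem fourier_expDiffKernel {s t t' : ℂ} (hs : 0 < s.re) (ht : 0 < t.re) (ht' : 0 < t'.re)
    (n : ℤ) :
    FourierTransform.fourier (expDiffKernel s t t') (n : ℝ) = Gamma s * poissonTerm s t t' n := by
  have hre : ∀ r : ℂ, (r + 2 * Real.pi * I * n).re = r.re := fun r => by simp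
  rw [Real.fourier_real_eq_integral_exp_smul, poissonTerm, mul_sub,
    ← laplace_cpow hs (by rwa [hre t]), ← laplace_cpow hs (by rwa [hre t']),
    ← integral_sub (integrableOn_cpow_mul_exp_neg_mul hs (by rwa [hre t]))
      (integrableOn_cpow_mul_exp_neg_mul hs (by rwa [hre t'])),
    ← integral_indicator measurableSet_Ioi]
  congr 1
  ext u
  by_cases hu : 0 < u
  · rw [indicator_of_mem (mem_Ioi.2 hu), expDiffKernel, if_pos hu, smul_eq_mul, ← mul_sub,
      mul_left_comm, mul_sub, ← exp_add, ← exp_add]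
    congr 3 <;> (push_cast; ring_nf)
  · rw [indicator_of_notMem (by simpa using hu), expDiffKernel, if_neg hu, smul_zero]

/-- `Σ_{m ≥ 1} m ^ (s - 1) e ^ (-m t)`. -/
noncomputable def powExpSum (s t : ℂ) : ℂ :=
  ∑' m : ℕ, ((m + 1 : ℕ) : ℂ) ^ (s - 1) * exp (-(t * (m + 1 : ℕ)))

theorem norm_powExpSum_term (s t : ℂ) (m : ℕ) :
    ‖((m + 1 : ℕ) : ℂ) ^ (s - 1) * exp (-(t * (m + 1 : ℕ)))‖ =
      ((m + 1 : ℕ) : ℝ) ^ (s.re - 1) * Real.exp (-(t.re * (m + 1 : ℕ))) := by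
  rw [norm_mul, norm_natCast_cpow_of_pos (by positivity), norm_exp]
  congr 2
  simp

theorem summable_rpow_mul_exp (a : ℝ) {b : ℝ} (hb : 0 < b) :
    Summable fun m : ℕ => ((m + 1 : ℕ) : ℝ) ^ a * Real.exp (-(b * (m + 1 : ℕ))) := by
  have h : Summable fun m : ℕ => (m : ℝ) ^ a * Real.exp (-(b * m)) := by
    refine summable_of_isBigO_nat (g := fun m : ℕ => (m : ℝ) ^ (-2 : ℝ))
      (Real.summable_nat_rpow.2 (by norm_num)) ?_
    have h := (isLittleO_exp_neg_mul_rpow_atTop hb (-2 - a)).isBigO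
    have h2 := (Asymptotics.isBigO_refl (fun u : ℝ => u ^ a) atTop).mul h
    refine (h2.comp_tendsto tendsto_natCast_atTop_atTop).congr' ?_ ?_
    · exact Eventually.of_forall fun m => by simp
    · filter_upwards [eventually_gt_atTop 0] with m hm
      have : (0 : ℝ) < m := by exact_mod_cast hm
      simp only [Function.comp]
      rw [← Real.rpow_add this]; congr 1; ring
  exact (summable_nat_add_iff 1).2 h

theorem summable_powExpSum (s : ℂ) {t : ℂ} (ht : 0 < t.re) :
    Summable fun m : ℕ => ((m + 1 : ℕ) : ℂ) ^ (s - 1) * exp (-(t * (m + 1 : ℕ))) := by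
  refine Summable.of_norm ?_
  simp_rw [norm_powExpSum_term]
  exact summable_rpow_mul_exp _ ht

theorem powExpSum_sub_eq_tsum {s t t' : ℂ} (hs : 0 < s.re) (ht : t ∈ sector) (ht' : t' ∈ sector)
    (ht0 : 0 < t.re) (ht0' : 0 < t'.re) :
    powExpSum s t - powExpSum s t' = Gamma s * ∑' n : ℤ, poissonTerm s t t' n := by
  have hsum : Summable fun n : ℤ =>
      FourierTransform.fourier (expDiffKernel s t t') (n : ℝ) := by
    simp_rw [fourier_expDiffKernel hs ht0 ht0']
    exact (summable_poissonTerm hs ht ht').mul_left _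
  have h := Real.tsum_eq_tsum_fourier_of_rpow_decay_of_summable
    (continuous_expDiffKernel hs ht0 ht0') one_lt_two (isBigO_expDiffKernel ht0 ht0') hsum 0
  simp only [zero_add, QuotientAddGroup.mk_zero, fourier_eval_zero, mul_one,
    fourier_expDiffKernel hs ht0 ht0', tsum_mul_left] at h
  rw [← h]
  have hpos : ∀ m : ℕ, expDiffKernel s t t' ((m + 1 : ℤ) : ℝ) =
      ((m + 1 : ℕ) : ℂ) ^ (s - 1) * exp (-(t * (m + 1 : ℕ))) -
      ((m + 1 : ℕ) : ℂ) ^ (s - 1) * exp (-(t' * (m + 1 : ℕ))) := by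
    intro m
    rw [expDiffKernel, if_pos (by push_cast; positivity), mul_sub]
    push_cast
    rfl
  have hneg : ∀ m : ℕ, expDiffKernel s t t' ((-(m + 1) : ℤ) : ℝ) = 0 := by
    intro m
    rw [expDiffKernel, if_neg (by push_cast; linarith [(Nat.cast_nonneg m : (0 : ℝ) ≤ m)])]
  have hs1 : HasSum (fun m : ℕ => expDiffKernel s t t' ((m + 1 : ℤ) : ℝ))
      (powExpSum s t - powExpSum s t') := by
    simp_rw [hpos]
    exact (summable_powExpSum s ht0).hasSum.sub (summable_powExpSum s ht0').hasSum
  have hs2 : HasSum (fun m : ℕ => expDiffKernel s t t' ((-(m + 1) : ℤ) : ℝ)) 0 := by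
    simp_rw [hneg]
    exact hasSum_zero
  have := (HasSum.of_add_one_of_neg_add_one (f := fun n : ℤ => expDiffKernel s t t' (n : ℝ))
    hs1 hs2).tsum_eq
  rw [this]
  simp [expDiffKernel]

/-! ### Expansion of the Dirichlet-type sum at the origin -/

/-- `Σ_{m ≥ 1} m ^ (s - 1) e ^ (-m t) - Γ(s) t ^ (-s)`. -/
noncomputable def powExpRem (s t : ℂ) : ℂ := powExpSum s t - Gamma s * t ^ (-s)

theorem powExpRem_sub_eq_tsum {s t t' : ℂ} (hs : 0 < s.re) (ht : t ∈ sector) (ht' : t' ∈ sector)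
    (ht0 : 0 < t.re) (ht0' : 0 < t'.re) :
    powExpRem s t - powExpRem s t' =
      Gamma s * ∑' n : ℤ, if n = 0 then 0 else poissonTerm s t t' n := by
  have h1 := powExpSum_sub_eq_tsum hs ht ht' ht0 ht0'
  rw [(summable_poissonTerm hs ht ht').tsum_eq_add_tsum_ite 0] at h1
  have h0 : poissonTerm s t t' 0 = t ^ (-s) - t' ^ (-s) := by simp [poissonTerm]
  rw [h0] at h1
  unfold powExpRem
  linear_combination h1

/-- A Lipschitz constant of `powExpRem s` on the sector. -/
noncomputable def powExpRemLip (s : ℂ) : ℝ :=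
  ‖Gamma s‖ * (‖s‖ * Real.exp (Real.pi * |s.im|) * ∑' n : ℤ, |(n : ℝ)| ^ (-(s.re + 1)))

theorem ofReal_mul_cpow_of_pos {r : ℝ} (hr : 0 < r) {z : ℂ} (hz : z ≠ 0) (s : ℂ) :
    ((r : ℂ) * z) ^ s = (r : ℂ) ^ s * z ^ s := by
  have hr' : (r : ℂ) ≠ 0 := ofReal_ne_zero.2 hr.ne'
  rw [cpow_def_of_ne_zero (mul_ne_zero hr' hz), cpow_def_of_ne_zero hr', cpow_def_of_ne_zero hz,
    log_ofReal_mul hr hz, add_mul, exp_add, ofReal_log hr.le]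

theorem zero_mem_sector : (0 : ℂ) ∈ sector := by simp [sector]

theorem ofReal_mem_sector {t : ℝ} (ht : 0 ≤ t) : (t : ℂ) ∈ sector := by simpa [sector] using ht

/-- The value of `powExpRem s` at `t = 0`, expressed through its value at `t = 1`. -/
noncomputable def powExpConst (s : ℂ) : ℂ :=
  powExpRem s 1 - Gamma s * ∑' n : ℤ, if n = 0 then 0 else poissonTerm s 1 0 n

theorem summable_poissonTerm_ite {s t t' : ℂ} (hs : 0 < s.re) (ht : t ∈ sector)
    (ht' : t' ∈ sector) : Summable fun n : ℤ => if n = 0 then 0 else poissonTerm s t t' n := by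
  refine (summable_poissonTerm hs ht ht').norm.of_norm_bounded fun n => ?_
  split_ifs <;> simp

/-- The nonzero frequencies make sense at `t' = 0` although the sum itself diverges there for some
`s`; comparing with `t' = 1` and telescoping `t → 1 → 0` reaches the vertex. -/
theorem powExpRem_sub_powExpConst {s t : ℂ} (hs : 0 < s.re) (ht : t ∈ sector) (ht0 : 0 < t.re) :
    powExpRem s t - powExpConst s =
      Gamma s * ∑' n : ℤ, if n = 0 then 0 else poissonTerm s t 0 n := by
  have h1 : (1 : ℂ) ∈ sector := by simp [sector]
  have h := powExpRem_sub_eq_tsum hs ht h1 ht0 (by simp)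
  have hadd := (summable_poissonTerm_ite hs ht h1).tsum_add
    (summable_poissonTerm_ite hs h1 zero_mem_sector)
  have hterm : ∀ n : ℤ, ((if n = 0 then 0 else poissonTerm s t 1 n) +
      if n = 0 then 0 else poissonTerm s 1 0 n) = if n = 0 then 0 else poissonTerm s t 0 n := by
    intro n
    split_ifs
    · simp
    · simp [poissonTerm]
  simp_rw [hterm] at hadd
  rw [hadd, powExpConst]
  linear_combination h

theorem norm_powExpRem_sub_powExpConst_le {s t : ℂ} (hs : 0 < s.re) (ht : t ∈ sector)
    (ht0 : 0 < t.re) : ‖powExpRem s t - powExpConst s‖ ≤ powExpRemLip s * ‖t‖ := by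
  rw [powExpRem_sub_powExpConst hs ht ht0, norm_mul, powExpRemLip, mul_assoc]
  refine mul_le_mul_of_nonneg_left ?_ (norm_nonneg _)
  have h := ((Real.summable_abs_int_rpow (b := s.re + 1) (by linarith)).mul_left
      (‖s‖ * Real.exp (Real.pi * |s.im|))).mul_right ‖t‖
  rw [← tsum_mul_left, ← tsum_mul_right]
  refine tsum_of_norm_bounded h.hasSum fun n => ?_
  split_ifs with hn
  · rw [norm_zero]; positivity
  · simpa using norm_poissonTerm_le hs ht zero_mem_sector hn

/-! ### The constant term as a value of `ζ` -/

theorem differentiableAt_tsum_poissonTerm {s : ℂ} (hs : 0 < s.re) :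
    DifferentiableAt ℂ (fun s => ∑' n : ℤ, if n = 0 then 0 else poissonTerm s 1 0 n) s := by
  have h1 : (1 : ℂ) ∈ sector := by simp [sector]
  set U : Set ℂ := {w | s.re / 2 < w.re} ∩ Metric.ball 0 (‖s‖ + 1) with hU
  have hUo : IsOpen U := (isOpen_lt continuous_const continuous_re).inter Metric.isOpen_ball
  have hsU : s ∈ U := ⟨by simp only [mem_ofPred_eq]; linarith, by simp⟩
  have hsum := (Real.summable_abs_int_rpow (b := s.re / 2 + 1) (by linarith)).mul_left
      ((‖s‖ + 1) * Real.exp (Real.pi * (‖s‖ + 1)))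
  refine (differentiableOn_tsum_of_summable_norm hsum (fun n => ?_) hUo
    (fun n w hw => ?_)).differentiableAt (hUo.mem_nhds hsU)
  · by_cases hn : n = 0
    · simp [hn]
    · simp only [hn, if_false, poissonTerm]
      have e1 := slitPlane_ne_zero (sector_add_mem_slitPlane h1 hn)
      have e2 := slitPlane_ne_zero (sector_add_mem_slitPlane zero_mem_sector hn)
      intro w _
      refine DifferentiableAt.differentiableWithinAt (DifferentiableAt.sub ?_ ?_)
      · exact (differentiableAt_id.neg).const_cpow (Or.inl e1)
      · exact (differentiableAt_id.neg).const_cpow (Or.inl e2)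
  · have hw1 : s.re / 2 < w.re := hw.1
    have hw2 : ‖w‖ < ‖s‖ + 1 := by simpa using hw.2
    split_ifs with hn
    · rw [norm_zero]; positivity
    · refine (norm_poissonTerm_le (by linarith) h1 zero_mem_sector hn).trans ?_
      have hn1 : (1 : ℝ) ≤ |(n : ℝ)| := by
        exact_mod_cast Int.one_le_abs hn
      have := (abs_im_le_norm w).trans hw2.le
      simp only [sub_zero, norm_one, mul_one]
      have h3 : |(n : ℝ)| ^ (-(w.re + 1)) ≤ |(n : ℝ)| ^ (-(s.re / 2 + 1)) :=
        Real.rpow_le_rpow_of_exponent_le hn1 (by linarith)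
      gcongr

theorem differentiableAt_powExpSum_one {s : ℂ} :
    DifferentiableAt ℂ (fun s => powExpSum s 1) s := by
  have hUo : IsOpen {w : ℂ | w.re < s.re + 1} := isOpen_lt continuous_re continuous_const
  refine (differentiableOn_tsum_of_summable_norm
    (summable_rpow_mul_exp (s.re + 1 - 1) (b := 1) one_pos) (fun n => ?_) hUo
    (fun n w hw => ?_)).differentiableAt (hUo.mem_nhds (by simp))
  · intro w _
    refine DifferentiableAt.differentiableWithinAt (DifferentiableAt.mul_const ?_ _)
    exact (differentiableAt_id.sub_const _).const_cpow (Or.inl (by exact_mod_cast n.succ_ne_zero))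
  · rw [norm_powExpSum_term]
    have hw : w.re < s.re + 1 := hw
    have h1 : (1 : ℝ) ≤ ((n + 1 : ℕ) : ℝ) := by exact_mod_cast Nat.le_add_left 1 n
    rw [one_re]
    gcongr

theorem differentiableOn_powExpConst : DifferentiableOn ℂ powExpConst {s | 0 < s.re} := by
  intro s hs
  have hs : 0 < s.re := hs
  have hG : DifferentiableAt ℂ Gamma s := differentiableAt_Gamma s fun m h => by
    rw [h] at hs; simp at hs; linarith [(Nat.cast_nonneg m : (0 : ℝ) ≤ m)]
  refine DifferentiableAt.differentiableWithinAt ?_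
  unfold powExpConst powExpRem
  simp only [one_cpow, mul_one]
  exact (differentiableAt_powExpSum_one.sub hG).sub (hG.mul (differentiableAt_tsum_poissonTerm hs))

theorem tendsto_ofReal_cpow_neg {s : ℂ} (hs : 0 < s.re) (a : ℂ) :
    Tendsto (fun t : ℝ => ((t : ℂ) + a) ^ (-s)) atTop (𝓝 0) := by
  have h1 : Tendsto (fun t : ℝ => ‖(t : ℂ) + a‖) atTop atTop := by
    refine tendsto_atTop_mono (f := fun t : ℝ => t + a.re) (fun t => ?_)
      (tendsto_atTop_add_const_right _ _ tendsto_id)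
    have := (le_abs_self _).trans (abs_re_le_norm ((t : ℂ) + a))
    simpa using this
  have h2 : Tendsto (fun t : ℝ => Real.exp (Real.pi * |s.im|) * ‖(t : ℂ) + a‖ ^ (-s.re)) atTop
      (𝓝 0) := by
    simpa using ((tendsto_rpow_neg_atTop hs).comp h1).const_mul (Real.exp (Real.pi * |s.im|))
  refine squeeze_zero_norm' ?_ h2
  filter_upwards [h1.eventually_gt_atTop 0] with t ht
  exact norm_cpow_le_of_le_norm ht le_rfl hs.le

theorem tendsto_powExpRem_atTop {s : ℂ} (hs : 0 < s.re) :
    Tendsto (fun t : ℝ => powExpRem s t) atTop (𝓝 0) := by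
  have h1 : Tendsto (fun t : ℝ => powExpSum s t) atTop (𝓝 (∑' _ : ℕ, (0 : ℂ))) := by
    refine tendsto_tsum_of_dominated_convergence
      (summable_rpow_mul_exp (s.re - 1) (b := 1) one_pos) (fun m => ?_) ?_
    · have : Tendsto (fun t : ℝ => ‖((m + 1 : ℕ) : ℂ) ^ (s - 1)‖ * Real.exp (-(t * (m + 1 : ℕ))))
          atTop (𝓝 (‖((m + 1 : ℕ) : ℂ) ^ (s - 1)‖ * 0)) := by
        refine Tendsto.const_mul _ (Real.tendsto_exp_neg_atTop_nhds_zero.comp ?_)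
        exact tendsto_id.atTop_mul_const (by positivity)
      rw [mul_zero] at this
      refine squeeze_zero_norm (fun t => ?_) this
      rw [norm_mul, norm_exp]; simp
    · filter_upwards [eventually_ge_atTop 1] with t ht m
      rw [norm_powExpSum_term]
      rw [ofReal_re]
      gcongr
  have h2 := (tendsto_ofReal_cpow_neg hs 0).const_mul (Gamma s)
  simpa [powExpRem] using h1.sub h2

/-- Let `t → ∞` along the reals in `powExpRem_sub_powExpConst`: the remainder and every `(t + 2 π i
n) ^ (-s)` vanish. Dominated convergence needs `Σ |n| ^ (-Re s)`, hence `Re s > 1`. -/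
theorem powExpConst_eq_tsum {s : ℂ} (hs : 1 < s.re) :
    powExpConst s =
      Gamma s * ∑' n : ℤ, if n = 0 then 0 else (2 * Real.pi * I * n : ℂ) ^ (-s) := by
  have hs0 : 0 < s.re := by linarith
  have hb : ∀ {t : ℂ}, t ∈ sector → ∀ n : ℤ, n ≠ 0 → ‖(t + 2 * Real.pi * I * n) ^ (-s)‖ ≤
      Real.exp (Real.pi * |s.im|) * |(n : ℝ)| ^ (-s.re) := fun ht n hn =>
    norm_cpow_le_of_le_norm (by positivity) (abs_le_norm_sector_add ht n) hs0.le
  have hsum := ((Real.summable_abs_int_rpow hs).mul_left (Real.exp (Real.pi * |s.im|))).mul_left 2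
  have h1 : Tendsto (fun t : ℝ => ∑' n : ℤ, if n = 0 then 0 else poissonTerm s t 0 n) atTop
      (𝓝 (∑' n : ℤ, if n = 0 then 0 else -(2 * Real.pi * I * n : ℂ) ^ (-s))) := by
    refine tendsto_tsum_of_dominated_convergence hsum (fun n => ?_) ?_
    · split_ifs with hn
      · exact tendsto_const_nhds
      · simpa [poissonTerm] using (tendsto_ofReal_cpow_neg hs0 (2 * Real.pi * I * n)).sub_const
          ((2 * Real.pi * I * n : ℂ) ^ (-s))
    · filter_upwards [eventually_ge_atTop 0] with t ht n
      split_ifs with hn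
      · rw [norm_zero]; positivity
      · refine (norm_sub_le _ _).trans ?_
        have e1 := hb (ofReal_mem_sector ht) n hn
        have e2 := hb zero_mem_sector n hn
        linarith
  have h2 := (tendsto_powExpRem_atTop hs0).sub (h1.const_mul (Gamma s))
  have h3 : Tendsto (fun _ : ℝ => powExpConst s) atTop (𝓝 (0 - Gamma s *
      ∑' n : ℤ, if n = 0 then 0 else -(2 * Real.pi * I * n : ℂ) ^ (-s))) := by
    refine h2.congr' ?_
    filter_upwards [eventually_gt_atTop 0] with t ht
    rw [← powExpRem_sub_powExpConst hs0 (ofReal_mem_sector ht.le) (by simpa using ht)]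
    ring
  rw [tendsto_nhds_unique tendsto_const_nhds h3]
  have : ∀ n : ℤ, (if n = 0 then 0 else -(2 * Real.pi * I * n : ℂ) ^ (-s)) =
      -(if n = 0 then 0 else (2 * Real.pi * I * n : ℂ) ^ (-s)) := fun n => by split_ifs <;> simp
  simp_rw [this, tsum_neg]
  ring

/-- The frequencies `n` and `-n` carry the phases `e ^ (∓ i π s / 2)`, which add to the cosine.
Multiplied by `Γ(s)`, this is the functional equation's expression for `ζ(1 - s)`. -/
theorem tsum_two_pi_I_mul_cpow {s : ℂ} (hs : 1 < s.re) :
    ∑' n : ℤ, (if n = 0 then 0 else (2 * Real.pi * I * n : ℂ) ^ (-s)) =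
      2 * (2 * Real.pi) ^ (-s) * cos (Real.pi * s / 2) * riemannZeta s := by
  have hz : HasSum (fun k : ℕ => ((k + 1 : ℝ) : ℂ) ^ (-s)) (riemannZeta s) := by
    have h := ((summable_nat_add_iff 1).2 (Complex.summable_one_div_nat_cpow.2 hs)).hasSum
    have e : ∀ k : ℕ, 1 / ((k + 1 : ℕ) : ℂ) ^ s = ((k + 1 : ℝ) : ℂ) ^ (-s) := fun k => by
      push_cast; rw [cpow_neg, one_div]
    rw [zeta_eq_tsum_one_div_nat_add_one_cpow hs]
    simpa [e, cpow_neg] using h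
  have hterm : ∀ (k : ℕ) (z : ℂ), z ≠ 0 → (((2 * Real.pi * (k + 1) : ℝ) : ℂ) * z) ^ (-s) =
      ((2 * Real.pi : ℝ) : ℂ) ^ (-s) * z ^ (-s) * ((k + 1 : ℝ) : ℂ) ^ (-s) := by
    intro k z hz
    rw [ofReal_mul_cpow_of_pos (by positivity) hz, ofReal_mul,
      mul_cpow_ofReal_nonneg (by positivity) (by positivity)]
    ring
  have hI : I ^ (-s) = exp (-(Real.pi * s / 2 * I)) := by
    rw [cpow_def_of_ne_zero I_ne_zero, log_I]; ring_nf
  have hnI : (-I) ^ (-s) = exp (Real.pi * s / 2 * I) := by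
    rw [cpow_def_of_ne_zero (neg_ne_zero.2 I_ne_zero), log_neg_I]; ring_nf
  have h1 := hz.mul_left (((2 * Real.pi : ℝ) : ℂ) ^ (-s) * I ^ (-s))
  have h2 := hz.mul_left (((2 * Real.pi : ℝ) : ℂ) ^ (-s) * (-I) ^ (-s))
  have h := HasSum.of_add_one_of_neg_add_one
    (f := fun n : ℤ => if n = 0 then 0 else (2 * Real.pi * I * n : ℂ) ^ (-s))
    (h1.congr_fun fun k => ?_) (h2.congr_fun fun k => ?_)
  · rw [h.tsum_eq, hI, hnI, cos, if_pos rfl]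
    push_cast
    ring_nf
  · rw [← hterm k I I_ne_zero, if_neg (by positivity)]
    congr 1; push_cast; ring
  · rw [← hterm k (-I) (neg_ne_zero.2 I_ne_zero), if_neg (by lia)]
    congr 1; push_cast; ring

/-- The constant term in the expansion of `Σ m ^ (s - 1) e ^ (-m t)` at `t = 0` is `ζ(1 - s)`. -/
theorem powExpConst_eq_riemannZeta {s : ℂ} (hs : 0 < s.re) :
    powExpConst s = riemannZeta (1 - s) := by
  have hopen : IsOpen {s : ℂ | 0 < s.re} := isOpen_lt continuous_const continuous_re
  have h1 := differentiableOn_powExpConst.analyticOnNhd hopen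
  have h2 : AnalyticOnNhd ℂ (fun s : ℂ => riemannZeta (1 - s)) {s | 0 < s.re} := by
    refine DifferentiableOn.analyticOnNhd (fun s hs => ?_) hopen
    have hs : 0 < s.re := hs
    have hne : 1 - s ≠ 1 := fun h => by
      have : s = 0 := by linear_combination -h
      rw [this] at hs; simp at hs
    exact ((differentiableAt_riemannZeta hne).comp s
      (differentiableAt_id.const_sub 1)).differentiableWithinAt
  refine h1.eqOn_of_preconnected_of_eventuallyEq h2 (convex_halfSpace_re_gt 0).isPreconnected
    (z₀ := 2) (by simp) ?_ hs
  filter_upwards [(isOpen_lt continuous_const continuous_re).mem_nhds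
    (show (2 : ℂ) ∈ {s : ℂ | 1 < s.re} by simp)] with w hw
  have hw : 1 < w.re := hw
  rw [powExpConst_eq_tsum hw, tsum_two_pi_I_mul_cpow hw, riemannZeta_one_sub]
  · ring
  · intro n h
    rw [h] at hw; simp at hw; linarith [(Nat.cast_nonneg n : (0 : ℝ) ≤ n)]
  · intro h
    rw [h] at hw; simp at hw

theorem norm_powExpSum_sub_le {s t : ℂ} (hs : 0 < s.re) (ht : t ∈ sector) (ht0 : 0 < t.re) :
    ‖powExpSum s t - Gamma s * t ^ (-s) - riemannZeta (1 - s)‖ ≤ powExpRemLip s * ‖t‖ := by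
  rw [← powExpConst_eq_riemannZeta hs]
  exact norm_powExpRem_sub_powExpConst_le hs ht ht0

/-! ### Logarithm of the generating product and Cauchy's formula -/

theorem powerSeq_pos (s : ℝ) (m : ℕ) : 0 < powerSeq s (m + 1) := by
  unfold powerSeq; positivity

theorem summable_powerSeq_mul_pow (s : ℝ) {r : ℝ} (hr : 0 < r) (hr1 : r < 1) :
    Summable fun m : ℕ => powerSeq s (m + 1) * r ^ (m + 1) := by
  have h := summable_rpow_mul_exp (s - 1) (b := -Real.log r) (by linarith [Real.log_neg hr hr1])
  refine h.congr fun m => ?_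
  rw [powerSeq, neg_mul, neg_neg, mul_comm (Real.log r), Real.exp_nat_mul, Real.exp_log hr]

/-- `Σ_{m ≥ 1} -a_m log (1 - x q ^ m)`. -/
noncomputable def logGenProduct (s x : ℝ) (q : ℂ) : ℂ :=
  ∑' m : ℕ, (powerSeq s (m + 1) : ℂ) * -log (1 - x * q ^ (m + 1))

theorem norm_mul_pow_succ_le {x : ℝ} (hx : x ∈ Ioo (0 : ℝ) 1) {q : ℂ} {r : ℝ} (hq : ‖q‖ ≤ r)
    (m : ℕ) : ‖(x : ℂ) * q ^ (m + 1)‖ ≤ x * r ^ (m + 1) := by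
  rw [norm_mul, norm_real, Real.norm_of_nonneg hx.1.le, norm_pow]
  have := hx.1
  gcongr

theorem norm_mul_pow_succ_lt_one {x : ℝ} (hx : x ∈ Ioo (0 : ℝ) 1) {q : ℂ} (hq : ‖q‖ < 1)
    (m : ℕ) : ‖(x : ℂ) * q ^ (m + 1)‖ < 1 := by
  refine (norm_mul_pow_succ_le hx hq.le m).trans_lt ?_
  simpa using hx.2

theorem norm_logGenProduct_term_le (s : ℝ) {x : ℝ} (hx : x ∈ Ioo (0 : ℝ) 1) {q : ℂ} {r : ℝ}
    (hq : ‖q‖ ≤ r) (hr1 : r < 1) (m : ℕ) :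
    ‖(powerSeq s (m + 1) : ℂ) * -log (1 - x * q ^ (m + 1))‖ ≤
      ((1 - x)⁻¹ + 1) * (powerSeq s (m + 1) * r ^ (m + 1)) := by
  have hr : 0 ≤ r := (norm_nonneg q).trans hq
  have hx0 := hx.1
  have hx1 := hx.2
  set w : ℂ := x * q ^ (m + 1) with hw
  have h1 : ‖w‖ ≤ x * r ^ (m + 1) := norm_mul_pow_succ_le hx hq m
  have hrm : r ^ (m + 1) ≤ 1 := pow_le_one₀ hr hr1.le
  have hrm0 : 0 ≤ r ^ (m + 1) := by positivity
  have h2 : ‖w‖ ≤ r ^ (m + 1) := by nlinarith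
  have h3 : ‖w‖ ≤ x := by nlinarith
  have h4 := norm_log_one_add_le (z := -w) (by rw [norm_neg]; linarith)
  rw [norm_neg, ← sub_eq_add_neg] at h4
  have h5 : (1 - ‖w‖)⁻¹ ≤ (1 - x)⁻¹ := inv_anti₀ (by linarith) (by linarith)
  have h6 : 0 < (1 - ‖w‖)⁻¹ := inv_pos.2 (by linarith)
  have h7 : ‖w‖ ^ 2 * (1 - ‖w‖)⁻¹ / 2 ≤ r ^ (m + 1) * (1 - x)⁻¹ := by
    have : ‖w‖ ^ 2 ≤ r ^ (m + 1) := by nlinarith [norm_nonneg w]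
    have h8 : ‖w‖ ^ 2 * (1 - ‖w‖)⁻¹ ≤ r ^ (m + 1) * (1 - x)⁻¹ := by gcongr
    have : 0 ≤ ‖w‖ ^ 2 * (1 - ‖w‖)⁻¹ := by positivity
    linarith
  rw [norm_mul, norm_neg, norm_real, Real.norm_of_nonneg (powerSeq_pos s m).le]
  calc _ ≤ powerSeq s (m + 1) * (r ^ (m + 1) * (1 - x)⁻¹ + r ^ (m + 1)) := by
        have := (powerSeq_pos s m).le
        gcongr; linarith
    _ = _ := by ring

theorem summable_logGenProduct (s : ℝ) {x : ℝ} (hx : x ∈ Ioo (0 : ℝ) 1) {q : ℂ} (hq : ‖q‖ < 1) :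
    Summable fun m : ℕ => (powerSeq s (m + 1) : ℂ) * -log (1 - x * q ^ (m + 1)) := by
  obtain ⟨r, hr, hr1⟩ := exists_between hq
  exact Summable.of_norm_bounded ((summable_powerSeq_mul_pow s ((norm_nonneg q).trans_lt hr)
    hr1).mul_left _) (norm_logGenProduct_term_le s hx hr.le hr1)

theorem genProduct_eq_exp (s : ℝ) {x : ℝ} (hx : x ∈ Ioo (0 : ℝ) 1) {q : ℂ} (hq : ‖q‖ < 1) :
    genProduct (powerSeq s) x q = exp (logGenProduct s x q) := by
  rw [logGenProduct, ← (summable_logGenProduct s hx hq).hasSum.cexp.tprod_eq, genProduct]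
  congr 1
  ext m
  have hne : (1 - (x : ℂ) * q ^ (m + 1)) ≠ 0 := fun h => by
    have := norm_mul_pow_succ_lt_one hx hq m
    rw [← sub_eq_zero.1 h] at this
    simp at this
  rw [Function.comp, cpow_def_of_ne_zero hne, one_div, ← exp_neg]
  congr 1; ring

theorem differentiableOn_logGenProduct (s : ℝ) {x : ℝ} (hx : x ∈ Ioo (0 : ℝ) 1) :
    DifferentiableOn ℂ (logGenProduct s x) (Metric.ball 0 1) := by
  intro q hq
  obtain ⟨r, hr, hr1⟩ := exists_between (mem_ball_zero_iff.1 hq)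
  refine ((differentiableOn_tsum_of_summable_norm ((summable_powerSeq_mul_pow s
    ((norm_nonneg q).trans_lt hr) hr1).mul_left ((1 - x)⁻¹ + 1)) (fun m w hw => ?_)
    Metric.isOpen_ball (fun m w hw => ?_)).differentiableAt
    (Metric.isOpen_ball.mem_nhds (mem_ball_zero_iff.2 hr))).differentiableWithinAt
  · have hw1 : ‖w‖ < 1 := (mem_ball_zero_iff.1 hw).trans hr1
    have hsl : 1 - (x : ℂ) * w ^ (m + 1) ∈ slitPlane := by
      have := mem_slitPlane_of_norm_lt_one (z := -((x : ℂ) * w ^ (m + 1)))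
        (by rw [norm_neg]; exact norm_mul_pow_succ_lt_one hx hw1 m)
      rwa [← sub_eq_add_neg] at this
    have hd : DifferentiableAt ℂ (fun w : ℂ => 1 - (x : ℂ) * w ^ (m + 1)) w := by fun_prop
    exact ((hd.clog hsl).neg.const_mul _).differentiableWithinAt
  · exact norm_logGenProduct_term_le s hx (mem_ball_zero_iff.1 hw).le hr1 m

theorem differentiableOn_genProduct (s : ℝ) {x : ℝ} (hx : x ∈ Ioo (0 : ℝ) 1) :
    DifferentiableOn ℂ (fun q => genProduct (powerSeq s) x q) (Metric.ball 0 1) :=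
  (differentiableOn_logGenProduct s hx).cexp.congr fun _ hq =>
    genProduct_eq_exp s hx (mem_ball_zero_iff.1 hq)

theorem norm_exp_neg_lt_one {τ : ℂ} (hτ : 0 < τ.re) : ‖exp (-τ)‖ < 1 := by
  rw [norm_exp]; simpa using hτ

theorem powExpSum_ofReal (s : ℝ) (t : ℂ) :
    powExpSum s t = ∑' m : ℕ, (powerSeq s (m + 1) : ℂ) * exp (-(t * (m + 1 : ℕ))) := by
  unfold powExpSum powerSeq
  congr 1; ext m
  rw [ofReal_cpow (by positivity)]
  push_cast; rfl

/-- Taylor expansion of each logarithm followed by Fubini. The double series is dominated by a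
product of two convergent series, because `|q| ^ ((m + 1) (k + 1)) ≤ |q| ^ (m + 1)`. -/
theorem hasSum_logGenProduct (s : ℝ) {x : ℝ} (hx : x ∈ Ioo (0 : ℝ) 1) {τ : ℂ} (hτ : 0 < τ.re) :
    HasSum (fun k : ℕ => ((x ^ (k + 1) / (k + 1) : ℝ) : ℂ) * powExpSum s ((k + 1 : ℕ) * τ))
      (logGenProduct s x (exp (-τ))) := by
  set f : ℕ × ℕ → ℂ := fun p => (powerSeq s (p.1 + 1) : ℂ) * ((x ^ (p.2 + 1) / (p.2 + 1) : ℝ) : ℂ) *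
    exp (-((p.2 + 1 : ℕ) * τ * (p.1 + 1 : ℕ))) with hf
  have hx0 := hx.1
  have hr1 := norm_exp_neg_lt_one hτ
  have hr0 : 0 < ‖exp (-τ)‖ := norm_pos_iff.2 (exp_ne_zero _)
  have hsum : Summable f := by
    have hgeo : Summable fun k : ℕ => x ^ (k + 1) :=
      (summable_nat_add_iff 1).2 (summable_geometric_of_lt_one hx.1.le hx.2)
    refine Summable.of_norm_bounded ((summable_powerSeq_mul_pow s hr0 hr1).mul_of_nonneg hgeo
      (fun m => mul_nonneg (powerSeq_pos s m).le (by positivity)) (fun k => by positivity)) ?_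
    rintro ⟨m, k⟩
    have e : exp (-((k + 1 : ℕ) * τ * (m + 1 : ℕ))) = (exp (-τ) ^ (m + 1)) ^ (k + 1) := by
      rw [← exp_nat_mul, ← exp_nat_mul]; ring_nf
    simp only [hf]
    rw [e, norm_mul, norm_mul, norm_real, norm_real, Real.norm_of_nonneg (powerSeq_pos s m).le,
      Real.norm_of_nonneg (by positivity), norm_pow, norm_pow]
    have h1 : x ^ (k + 1) / (k + 1) ≤ x ^ (k + 1) := div_le_self (by positivity) (by simp)
    have h2 : (‖exp (-τ)‖ ^ (m + 1)) ^ (k + 1) ≤ ‖exp (-τ)‖ ^ (m + 1) :=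
      pow_le_of_le_one (by positivity) (pow_le_one₀ hr0.le hr1.le) (by simp)
    have := (powerSeq_pos s m).le
    calc _ ≤ powerSeq s (m + 1) * x ^ (k + 1) * ‖exp (-τ)‖ ^ (m + 1) := by gcongr
      _ = _ := by ring
  have hrow : ∀ m : ℕ, ∑' k : ℕ, f (m, k) =
      (powerSeq s (m + 1) : ℂ) * -log (1 - x * exp (-τ) ^ (m + 1)) := by
    intro m
    rw [← (hasSum_taylorSeries_neg_log' (norm_mul_pow_succ_lt_one hx hr1 m)).tsum_eq,
      ← tsum_mul_left]
    congr 1; ext k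
    simp only [hf]
    rw [mul_pow, ← exp_nat_mul, ← exp_nat_mul]
    push_cast
    ring_nf
  have hcol : ∀ k : ℕ, ∑' m : ℕ, f (m, k) =
      ((x ^ (k + 1) / (k + 1) : ℝ) : ℂ) * powExpSum s ((k + 1 : ℕ) * τ) := by
    intro k
    rw [powExpSum_ofReal, ← tsum_mul_left]
    congr 1; ext m
    simp only [hf]
    ring
  have h1 : ∑' p, f p = logGenProduct s x (exp (-τ)) := by
    rw [hsum.tsum_prod, logGenProduct]
    congr 1; ext m; exact hrow m
  rw [← h1]
  have hswap : HasSum (f ∘ Prod.swap) (∑' p, f p) :=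
    (Equiv.prodComm ℕ ℕ).hasSum_iff.2 hsum.hasSum
  have := hswap.prod_fiberwise (g := fun k => ∑' m : ℕ, f (m, k)) fun k =>
    (hswap.summable.prod_factor k).hasSum
  simpa only [hcol] using this

/-- Cauchy's formula for the coefficients on the circle of radius `e ^ (-σ)`. -/
theorem genCoeff_eq_integral (s : ℝ) {x : ℝ} (hx : x ∈ Ioo (0 : ℝ) 1) {σ : ℝ} (hσ : 0 < σ)
    (n : ℕ) :
    genCoeff (powerSeq s) n x = 1 / (2 * Real.pi) * ∫ θ in (-Real.pi)..Real.pi,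
      exp (n * (σ + θ * I) + logGenProduct s x (exp (-(σ + θ * I)))) := by
  set P : ℂ → ℂ := fun q => genProduct (powerSeq s) x q with hP
  have hR : Real.exp (-σ) < 1 := by simpa using hσ
  have hC := DifferentiableOn.circleIntegral_one_div_sub_center_pow_smul (Real.exp_pos (-σ)) n
    ((differentiableOn_genProduct s hx).mono
      (Metric.closedBall_subset_ball (x := (0 : ℂ)) hR))
  have hfac : (n.factorial : ℂ) ≠ 0 := by exact_mod_cast n.factorial_ne_zero
  have hpi : (Real.pi : ℂ) ≠ 0 := by exact_mod_cast Real.pi_ne_zero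
  set g : ℂ → ℂ := fun q => 1 / q ^ n * P q with hg
  have h1 : ∮ z in C(0, Real.exp (-σ)), (1 / (z - 0) ^ (n + 1)) • P z =
      I * ∫ θ in (0 : ℝ)..2 * Real.pi, g (circleMap 0 (Real.exp (-σ)) θ) := by
    rw [circleIntegral, ← intervalIntegral.integral_const_mul]
    congr 1; ext θ
    have hne := circleMap_ne_center (c := 0) (Real.exp_pos (-σ)).ne' (θ := θ)
    rw [deriv_circleMap, hg]
    simp only [smul_eq_mul, sub_zero]
    field_simp
    ring
  rw [h1] at hC
  have hper : Function.Periodic (fun θ : ℝ => g (circleMap 0 (Real.exp (-σ)) θ)) (2 * Real.pi) :=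
    (periodic_circleMap 0 _).comp g
  have h2 := hper.intervalIntegral_add_eq 0 (-Real.pi)
  rw [zero_add, show -Real.pi + 2 * Real.pi = Real.pi by ring] at h2
  rw [h2] at hC
  -- Reflecting `θ` turns the point of the circle into `e ^ (-(σ + i θ))`.
  have h3 := intervalIntegral.integral_comp_neg (a := -Real.pi) (b := Real.pi)
    (fun θ : ℝ => g (circleMap 0 (Real.exp (-σ)) θ))
  rw [neg_neg] at h3
  rw [← h3] at hC
  have h4 : ∀ θ : ℝ, g (circleMap 0 (Real.exp (-σ)) (-θ)) =
      exp (n * (σ + θ * I) + logGenProduct s x (exp (-(σ + θ * I)))) := by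
    intro θ
    have e : circleMap 0 (Real.exp (-σ)) (-θ) = exp (-(σ + θ * I)) := by
      rw [circleMap, zero_add, ofReal_exp, ← exp_add]; push_cast; ring_nf
    rw [e, hg, hP]
    simp only
    rw [genProduct_eq_exp s hx (norm_exp_neg_lt_one (by simpa using hσ)), exp_add, ← exp_nat_mul,
      one_div, ← exp_neg]
    ring_nf
  simp_rw [h4] at hC
  rw [genCoeff]
  simp only [smul_eq_mul] at hC
  set J := ∫ θ in (-Real.pi)..Real.pi,
      exp (n * (σ + θ * I) + logGenProduct s x (exp (-(σ + θ * I)))) with hJ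
  field_simp
  have hI := I_ne_zero
  field_simp at hC
  linear_combination -hC

theorem hasSum_polylog (s : ℝ) (hs : 0 ≤ s) {x : ℝ} (hx : x ∈ Ioo (0 : ℝ) 1) :
    HasSum (fun j : ℕ => x ^ (j + 1) / ((j + 1 : ℕ) : ℝ) ^ s) (polylog s x) := by
  have hx0 := hx.1
  have hgeo : Summable fun k : ℕ => x ^ (k + 1) :=
    (summable_nat_add_iff 1).2 (summable_geometric_of_lt_one hx.1.le hx.2)
  refine (Summable.of_nonneg_of_le (fun j => by positivity) (fun j => ?_) hgeo).hasSum
  refine div_le_self (by positivity) (Real.one_le_rpow ?_ hs)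
  exact_mod_cast Nat.le_add_left 1 j

theorem hasSum_pow_succ {x : ℝ} (hx : x ∈ Ioo (0 : ℝ) 1) :
    HasSum (fun k : ℕ => x ^ (k + 1)) (x / (1 - x)) := by
  have := (hasSum_geometric_of_lt_one hx.1.le hx.2).mul_left x
  simpa [pow_succ', div_eq_mul_inv] using this

theorem smul_mem_sector {τ : ℂ} (hτ : τ ∈ sector) (k : ℕ) : ((k : ℕ) : ℂ) * τ ∈ sector := by
  have h : |τ.im| ≤ τ.re := hτ
  simp only [sector, mem_ofPred_eq, ← ofReal_natCast, im_ofReal_mul, re_ofReal_mul, abs_mul,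
    Nat.abs_cast]
  gcongr

/-- The leading part of `log P(x, e ^ (-τ))` as `τ → 0`. -/
theorem norm_logGenProduct_sub_le {s : ℝ} (hs : 0 < s) {x : ℝ} (hx : x ∈ Ioo (0 : ℝ) 1) {τ : ℂ}
    (hτ : τ ∈ sector) (hτ0 : 0 < τ.re) :
    ‖logGenProduct s x (exp (-τ)) - ((Real.Gamma s * polylog (s + 1) x : ℝ) * τ ^ (-(s : ℂ))
        + log (1 - x) * -riemannZeta (1 - s))‖ ≤ powExpRemLip s * (x / (1 - x)) * ‖τ‖ := by
  have hx0 := hx.1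
  have hτne : τ ≠ 0 := fun h => by simp [h] at hτ0
  have h1 := hasSum_logGenProduct s hx hτ0
  have h2 : HasSum (fun k : ℕ => ((x ^ (k + 1) / (k + 1) : ℝ) : ℂ) *
      (Gamma s * (((k + 1 : ℕ) : ℂ) * τ) ^ (-(s : ℂ))))
      ((Real.Gamma s * polylog (s + 1) x : ℝ) * τ ^ (-(s : ℂ))) := by
    have h := ((hasSum_ofReal.2 (hasSum_polylog (s + 1) (by linarith) hx)).mul_left
      ((Real.Gamma s : ℝ) : ℂ)).mul_right (τ ^ (-(s : ℂ)))
    rw [← ofReal_mul] at h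
    refine h.congr_fun fun k => ?_
    have hk : (0 : ℝ) < ((k + 1 : ℕ) : ℝ) := by positivity
    rw [Gamma_ofReal, ← ofReal_natCast, ofReal_mul_cpow_of_pos hk hτne, ← ofReal_neg,
      ← ofReal_cpow hk.le, Real.rpow_add_one hk.ne', Real.rpow_neg hk.le]
    push_cast
    field_simp
  have h3 : HasSum (fun k : ℕ => ((x ^ (k + 1) / (k + 1) : ℝ) : ℂ) * riemannZeta (1 - s))
      (log (1 - x) * -riemannZeta (1 - s)) := by
    have h := (hasSum_taylorSeries_neg_log' (z := (x : ℂ)) (by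
      rw [norm_real, Real.norm_of_nonneg hx0.le]; exact hx.2)).mul_right (riemannZeta (1 - s))
    rw [mul_neg, ← neg_mul]
    refine h.congr_fun fun k => ?_
    push_cast; rfl
  have h4 := h1.sub (h2.add h3)
  rw [← h4.tsum_eq]
  refine tsum_of_norm_bounded (((hasSum_pow_succ hx).mul_left (powExpRemLip s)).mul_right ‖τ‖)
    fun k => ?_
  have h5 := norm_powExpSum_sub_le (s := s) (by simpa using hs) (smul_mem_sector hτ (k + 1))
    (by rw [← ofReal_natCast, re_ofReal_mul]; positivity)
  rw [← mul_add, ← mul_sub, norm_mul, norm_real, Real.norm_of_nonneg (by positivity), ← sub_sub]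
  -- The Taylor denominator `k + 1` cancels the dilation of `τ`, leaving a geometric series.
  calc _ ≤ x ^ (k + 1) / (k + 1) * (powExpRemLip s * ‖((k + 1 : ℕ) : ℂ) * τ‖) := by gcongr
    _ = _ := by
      rw [norm_mul, Complex.norm_natCast]; push_cast; field_simp

/-! ### Minor arcs -/

theorem re_powExpSum_term (s : ℝ) (σ θ : ℝ) (m : ℕ) :
    ((powerSeq s (m + 1) : ℂ) * exp (-((σ + θ * I) * (m + 1 : ℕ)))).re =
      powerSeq s (m + 1) * (Real.exp (-(σ * (m + 1 : ℕ))) * Real.cos (θ * (m + 1 : ℕ))) := by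
  rw [re_ofReal_mul, exp_re]
  simp

/-- The drop of `Re log P` between `σ` and `σ + i θ`. -/
theorem hasSum_re_powExpSum_sub (s : ℝ) {σ : ℝ} (hσ : 0 < σ) (θ : ℝ) :
    HasSum (fun m : ℕ => powerSeq s (m + 1) * Real.exp (-(σ * (m + 1 : ℕ))) *
        (1 - Real.cos (θ * (m + 1 : ℕ))))
      ((powExpSum s σ).re - (powExpSum s (σ + θ * I)).re) := by
  have key : ∀ θ : ℝ, HasSum (fun m : ℕ => powerSeq s (m + 1) *
      (Real.exp (-(σ * (m + 1 : ℕ))) * Real.cos (θ * (m + 1 : ℕ))))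
      (powExpSum s (σ + θ * I)).re := by
    intro θ
    have h := (summable_powExpSum s (t := σ + θ * I) (by simpa using hσ)).hasSum
    have h2 : HasSum (fun m : ℕ => (powerSeq s (m + 1) : ℂ) *
        exp (-((σ + θ * I) * (m + 1 : ℕ)))) (powExpSum s (σ + θ * I)) := by
      refine h.congr_fun fun m => ?_
      rw [powerSeq, ofReal_cpow (by positivity)]
      push_cast; rfl
    simpa only [re_powExpSum_term] using hasSum_re h2
  have h := (key 0).sub (key θ)
  simp only [ofReal_zero, zero_mul, add_zero, Real.cos_zero] at h
  refine h.congr_fun fun m => ?_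
  ring

theorem re_powExpSum_sub_nonneg (s : ℝ) {σ : ℝ} (hσ : 0 < σ) (θ : ℝ) :
    0 ≤ (powExpSum s σ).re - (powExpSum s (σ + θ * I)).re :=
  (hasSum_re_powExpSum_sub s hσ θ).nonneg fun m =>
    mul_nonneg (mul_nonneg (powerSeq_pos s m).le (Real.exp_pos _).le)
      (by linarith [Real.cos_le_one (θ * (m + 1 : ℕ))])

/-- The cosines form the real part of a geometric sum with ratio `w = e ^ (i θ)`, of size at most `2
/ |w - 1|`. Since `|w - 1| ≥ 2 |θ| / π` by Jordan's inequality, this is at most `N / 2`. -/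
theorem sum_one_sub_cos_ge {θ : ℝ} (hθ0 : θ ≠ 0) (hθ : |θ| ≤ Real.pi) {N : ℕ}
    (hN : 2 * Real.pi ≤ N * |θ|) :
    (N : ℝ) / 2 ≤ ∑ j ∈ Finset.range N, (1 - Real.cos (θ * (N + j + 1 : ℕ))) := by
  have hsin : |θ| / Real.pi ≤ |Real.sin (θ / 2)| := by
    have h := Real.mul_abs_le_abs_sin (x := θ / 2) (by rw [abs_div, abs_two]; linarith)
    rw [abs_div, abs_two] at h
    calc _ = 2 / Real.pi * (|θ| / 2) := by ring
      _ ≤ _ := h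
  have hθpos : 0 < |θ| := abs_pos.2 hθ0
  have hpi := Real.pi_pos
  set w : ℂ := exp (θ * I) with hw
  have hw1 : ‖w - 1‖ = 2 * |Real.sin (θ / 2)| := by
    rw [hw, mul_comm (θ : ℂ) I, norm_exp_I_mul_ofReal_sub_one, norm_mul]
    simp
  have hcos : ∀ m : ℕ, Real.cos (θ * m) = (w ^ m).re := by
    intro m
    rw [hw, ← exp_nat_mul, ← mul_assoc, mul_comm (m : ℂ), ← ofReal_natCast, ← ofReal_mul,
      exp_ofReal_mul_I_re]
  have hgeo : ‖∑ j ∈ Finset.range N, w ^ (N + j + 1)‖ ≤ N / 2 := by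
    have hsplit : ∑ j ∈ Finset.range N, w ^ (N + j + 1) =
        w ^ (N + 1) * ∑ j ∈ Finset.range N, w ^ j := by
      rw [Finset.mul_sum]; congr 1; ext j; ring
    have hnw : ‖w‖ = 1 := norm_exp_ofReal_mul_I θ
    have h0 : 0 < ‖w - 1‖ := by rw [hw1]; have : 0 < |θ| / Real.pi := by positivity
                                linarith
    have hmul := geom_sum_mul w N
    have h2 : ‖∑ j ∈ Finset.range N, w ^ j‖ * ‖w - 1‖ ≤ 2 := by
      rw [← norm_mul, hmul]
      refine (norm_sub_le _ _).trans ?_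
      rw [norm_pow, hnw]; norm_num
    rw [hsplit, norm_mul, norm_pow, hnw, one_pow, one_mul]
    have h3 : 2 * (|θ| / Real.pi) ≤ ‖w - 1‖ := by rw [hw1]; linarith
    have h4 : 4 ≤ N * ‖w - 1‖ := by
      calc (4 : ℝ) = 2 * Real.pi * (2 / Real.pi) := by field_simp; norm_num
        _ ≤ N * |θ| * (2 / Real.pi) := by gcongr
        _ = N * (2 * (|θ| / Real.pi)) := by ring
        _ ≤ _ := by gcongr
    by_contra! hcon
    nlinarith
  have hre := (le_abs_self _).trans ((abs_re_le_norm _).trans hgeo)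
  rw [re_sum] at hre
  rw [Finset.sum_sub_distrib]
  simp only [Finset.sum_const, Finset.card_range, nsmul_eq_mul, mul_one, hcos]
  linarith

/-- All terms of the drop are nonnegative, so one may keep just the block `N < m ≤ 2 N` with `N ≈ K
/ σ`. There the exponential weight is bounded below and `m ^ (s - 1)` is of order `N ^ (s - 1)`; `K
= 2 π / δ` makes the block long enough for cancellation at every admissible `θ`. -/
theorem re_powExpSum_sub_ge {s : ℝ} (hs : 0 < s) {δ : ℝ} (hδ : 0 < δ) :
    ∃ c > 0, ∀ σ ∈ Ioc (0 : ℝ) 1, ∀ θ : ℝ, δ * σ ≤ |θ| → |θ| ≤ Real.pi →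
      c * σ ^ (-s) ≤ (powExpSum s σ).re - (powExpSum s (σ + θ * I)).re := by
  have hpi := Real.pi_pos
  set K := 2 * Real.pi / δ with hK
  have hK0 : 0 < K := by positivity
  refine ⟨K ^ s / 4 * Real.exp (-(2 * (K + 1))), by positivity, fun σ hσ θ h1 h2 => ?_⟩
  have hσ0 := hσ.1
  have hσ1 := hσ.2
  set N := ⌈K / σ⌉₊ with hN
  have hN1 : K / σ ≤ N := Nat.le_ceil _
  have hN2 : (N : ℝ) ≤ (K + 1) / σ := by
    have := Nat.ceil_lt_add_one (a := K / σ) (by positivity)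
    have h3 : 1 ≤ 1 / σ := by rw [le_div_iff₀ hσ0]; linarith
    rw [add_div]; linarith
  have hN0 : (0 : ℝ) < N := lt_of_lt_of_le (by positivity) hN1
  have hθ0 : θ ≠ 0 := fun h => by
    rw [h, abs_zero] at h1; nlinarith [mul_pos hδ hσ0]
  have hNθ : 2 * Real.pi ≤ N * |θ| := by
    calc 2 * Real.pi = K / σ * (δ * σ) := by rw [hK]; field_simp
      _ ≤ N * |θ| := by gcongr
  have hsum := sum_one_sub_cos_ge hθ0 h2 hNθ
  have hH := hasSum_re_powExpSum_sub s hσ0 θ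
  have hnn : ∀ m : ℕ, 0 ≤ powerSeq s (m + 1) * Real.exp (-(σ * (m + 1 : ℕ))) *
        (1 - Real.cos (θ * (m + 1 : ℕ))) := fun m =>
    mul_nonneg (mul_nonneg (powerSeq_pos s m).le (Real.exp_pos _).le)
      (by linarith [Real.cos_le_one (θ * (m + 1 : ℕ))])
  have hfin := sum_le_hasSum (Finset.Ico N (2 * N)) (fun m _ => hnn m) hH
  rw [Finset.sum_Ico_eq_sum_range, show 2 * N - N = N by lia] at hfin
  refine le_trans ?_ hfin
  have hterm : ∀ j ∈ Finset.range N,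
      (N : ℝ) ^ s / (2 * N) * Real.exp (-(2 * (K + 1))) * (1 - Real.cos (θ * (N + j + 1 : ℕ))) ≤
      powerSeq s (N + j + 1) * Real.exp (-(σ * (N + j + 1 : ℕ))) *
        (1 - Real.cos (θ * (N + j + 1 : ℕ))) := by
    intro j hj
    have hj' : j + 1 ≤ N := Finset.mem_range.1 hj
    have hj2 : ((j : ℝ) + 1) ≤ N := by exact_mod_cast hj'
    have hm0 : (0 : ℝ) < (N + j + 1 : ℕ) := by positivity
    -- Splitting off `1 / m` treats `s < 1` and `s ≥ 1` together: `m ^ s ≥ N ^ s` and `1 / m ≥ 1 /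
    -- (2 N)`.
    have e1 : (N : ℝ) ^ s / (2 * N) ≤ powerSeq s (N + j + 1) := by
      rw [powerSeq, Real.rpow_sub_one hm0.ne']
      have : (N : ℝ) ≤ (N + j + 1 : ℕ) := by push_cast; linarith [(Nat.cast_nonneg j : (0:ℝ) ≤ j)]
      gcongr
      push_cast; linarith
    have e2 : Real.exp (-(2 * (K + 1))) ≤ Real.exp (-(σ * (N + j + 1 : ℕ))) := by
      refine Real.exp_le_exp.2 (neg_le_neg ?_)
      calc σ * (N + j + 1 : ℕ) ≤ σ * (2 * N) := by gcongr; push_cast; linarith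
        _ ≤ σ * (2 * ((K + 1) / σ)) := by gcongr
        _ = _ := by field_simp
    have e3 : 0 ≤ 1 - Real.cos (θ * (N + j + 1 : ℕ)) := by
      linarith [Real.cos_le_one (θ * (N + j + 1 : ℕ))]
    have e4 := (powerSeq_pos s (N + j)).le
    gcongr
  refine le_trans ?_ (Finset.sum_le_sum hterm)
  rw [← Finset.mul_sum]
  calc _ = (K / σ) ^ s / 4 * Real.exp (-(2 * (K + 1))) := by
        rw [Real.div_rpow hK0.le hσ0.le, Real.rpow_neg hσ0.le]; ring
    _ ≤ (N : ℝ) ^ s / 4 * Real.exp (-(2 * (K + 1))) := by gcongr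
    _ = (N : ℝ) ^ s / (2 * N) * Real.exp (-(2 * (K + 1))) * (N / 2) := by field_simp; norm_num
    _ ≤ _ := by gcongr

/-- Off the major arc `|θ| ≤ δ σ` the modulus of the generating product is exponentially small
compared with its value on the positive axis. -/
theorem re_logGenProduct_le {s : ℝ} (hs : 0 < s) {δ : ℝ} (hδ : 0 < δ) :
    ∃ c > 0, ∀ x ∈ Ioo (0 : ℝ) 1, ∀ σ ∈ Ioc (0 : ℝ) 1, ∀ θ : ℝ, δ * σ ≤ |θ| → |θ| ≤ Real.pi →
      (logGenProduct s x (exp (-(σ + θ * I)))).re ≤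
        (logGenProduct s x (exp (-σ))).re - c * x * σ ^ (-s) := by
  obtain ⟨c, hc, h⟩ := re_powExpSum_sub_ge hs hδ
  refine ⟨c, hc, fun x hx σ hσ θ h1 h2 => ?_⟩
  have hx0 := hx.1
  have hσ0 := hσ.1
  have hH := (hasSum_re (hasSum_logGenProduct s hx (τ := σ) (by simpa using hσ0))).sub
    (hasSum_re (hasSum_logGenProduct s hx (τ := σ + θ * I) (by simpa using hσ0)))
  have e : ∀ k : ℕ, (((x ^ (k + 1) / (k + 1) : ℝ) : ℂ) *
      powExpSum s ((k + 1 : ℕ) * σ)).re - (((x ^ (k + 1) / (k + 1) : ℝ) : ℂ) *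
      powExpSum s ((k + 1 : ℕ) * (σ + θ * I))).re = x ^ (k + 1) / (k + 1) *
      ((powExpSum s (((k + 1 : ℕ) * σ : ℝ) : ℂ)).re -
        (powExpSum s (((k + 1 : ℕ) * σ : ℝ) + ((k + 1 : ℕ) * θ : ℝ) * I)).re) := by
    intro k
    rw [re_ofReal_mul, re_ofReal_mul]
    push_cast
    ring_nf
  simp only [e] at hH
  -- Only `k = 0` is used: for larger `k` the angle `(k + 1) θ` may be close to a multiple of `2 π`,
  -- and nonnegativity is all that is available.
  have h0 := le_hasSum hH 0 fun k _ => mul_nonneg (by positivity)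
    (re_powExpSum_sub_nonneg s (by positivity) _)
  have h3 := h σ hσ θ h1 h2
  simp only [zero_add, pow_one, Nat.cast_zero, div_one, Nat.cast_one, one_mul] at h0
  have h4 := mul_le_mul_of_nonneg_left h3 hx0.le
  linarith

/-! ### Local analysis at the saddle point -/

theorem norm_exp_sub_exp_le {u v : ℂ} {m : ℝ} (hu : u.re ≤ m) (hv : v.re ≤ m) :
    ‖exp u - exp v‖ ≤ ‖u - v‖ * Real.exp m := by
  have := (convex_halfSpace_re_le m).norm_image_sub_le_of_norm_hasDerivWithin_le
    (f := exp) (f' := exp) (C := Real.exp m) (x := v) (y := u)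
    (fun w _ => (hasDerivAt_exp w).hasDerivWithinAt)
    (fun w hw => by rw [norm_exp]; exact Real.exp_le_exp.2 hw) hv hu
  rwa [mul_comm] at this

/-- The induction step for Taylor remainders of `(1 + z) ^ (-a)`: the derivative of each remainder
is `-a` times the preceding one with `a + 1` in place of `a`. -/
theorem norm_le_mul_pow_succ_of_norm_deriv_le {f f' : ℂ → ℂ} {r M : ℝ} {k : ℕ}
    (hf : ∀ z, ‖z‖ ≤ r → HasDerivAt f (f' z) z) (hf0 : f 0 = 0) (hM : 0 ≤ M)
    (hf' : ∀ z, ‖z‖ ≤ r → ‖f' z‖ ≤ M * ‖z‖ ^ k) {z : ℂ} (hz : ‖z‖ ≤ r) :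
    ‖f z‖ ≤ M * ‖z‖ ^ (k + 1) := by
  have := (convex_closedBall (0 : ℂ) ‖z‖).norm_image_sub_le_of_norm_hasDerivWithin_le
    (f := f) (f' := f') (C := M * ‖z‖ ^ k) (x := 0) (y := z)
    (fun w hw => (hf w ((mem_closedBall_zero_iff.1 hw).trans hz)).hasDerivWithinAt)
    (fun w hw => ?_) (by simp) (by simp)
  · rw [hf0, sub_zero, sub_zero] at this
    rw [pow_succ, ← mul_assoc]; exact this
  · have hw' := mem_closedBall_zero_iff.1 hw
    refine (hf' w (hw'.trans hz)).trans ?_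
    gcongr

theorem one_add_mem_slitPlane {z : ℂ} (hz : ‖z‖ ≤ 1 / 2) : 1 + z ∈ slitPlane :=
  mem_slitPlane_of_norm_lt_one (by linarith)

theorem hasDerivAt_one_add_cpow_neg (a : ℝ) {z : ℂ} (hz : ‖z‖ ≤ 1 / 2) :
    HasDerivAt (fun z : ℂ => (1 + z) ^ (-(a : ℂ))) (-a * (1 + z) ^ (-((a + 1 : ℝ) : ℂ))) z := by
  have h := ((hasDerivAt_id' z).const_add 1).cpow_const (c := -(a : ℂ)) (one_add_mem_slitPlane hz)
  rw [mul_one] at h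
  convert! h using 3
  push_cast; ring

theorem norm_one_add_cpow_neg_le {a : ℝ} (ha : 0 ≤ a) {z : ℂ} (hz : ‖z‖ ≤ 1 / 2) :
    ‖(1 + z) ^ (-(a : ℂ))‖ ≤ (1 / 2) ^ (-a) := by
  have h : (1 / 2 : ℝ) ≤ ‖1 + z‖ := by
    have := norm_sub_norm_le (1 : ℂ) (-z)
    rw [norm_neg, norm_one, sub_neg_eq_add] at this
    linarith
  simpa using norm_cpow_le_of_le_norm (s := a) (by norm_num) h (by simpa using ha)

theorem norm_one_add_cpow_sub_one_le {a : ℝ} (ha : 0 ≤ a) {z : ℂ} (hz : ‖z‖ ≤ 1 / 2) :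
    ‖(1 + z) ^ (-(a : ℂ)) - 1‖ ≤ a * (1 / 2) ^ (-(a + 1)) * ‖z‖ := by
  have := norm_le_mul_pow_succ_of_norm_deriv_le (k := 0) (M := a * (1 / 2) ^ (-(a + 1)))
    (fun z hz => (hasDerivAt_one_add_cpow_neg a hz).sub_const 1) (by simp) (by positivity)
    (fun w hw => ?_) hz
  · simpa using this
  · rw [norm_mul, norm_neg, norm_real, Real.norm_of_nonneg ha, pow_zero, mul_one]
    gcongr
    exact norm_one_add_cpow_neg_le (by linarith) hw

theorem norm_one_add_cpow_sub_linear_le {a : ℝ} (ha : 0 ≤ a) {z : ℂ} (hz : ‖z‖ ≤ 1 / 2) :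
    ‖(1 + z) ^ (-(a : ℂ)) - 1 + a * z‖ ≤ a * ((a + 1) * (1 / 2) ^ (-(a + 1 + 1))) * ‖z‖ ^ 2 := by
  refine norm_le_mul_pow_succ_of_norm_deriv_le (k := 1)
    (f := fun z => (1 + z) ^ (-(a : ℂ)) - 1 + a * z)
    (f' := fun z => -a * ((1 + z) ^ (-((a + 1 : ℝ) : ℂ)) - 1)) (fun z hz => ?_) (by simp)
    (by positivity) (fun w hw => ?_) hz
  · refine (((hasDerivAt_one_add_cpow_neg a hz).sub_const 1).fun_add
      ((hasDerivAt_id' z).const_mul (a : ℂ))).congr_deriv ?_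
    ring
  · rw [norm_mul, norm_neg, norm_real, Real.norm_of_nonneg ha, pow_one, mul_assoc]
    gcongr
    exact norm_one_add_cpow_sub_one_le (by linarith) hw

theorem norm_one_add_cpow_sub_quadratic_le {a : ℝ} (ha : 0 ≤ a) {z : ℂ} (hz : ‖z‖ ≤ 1 / 2) :
    ‖(1 + z) ^ (-(a : ℂ)) - 1 + a * z - a * (a + 1) / 2 * z ^ 2‖ ≤
      a * ((a + 1) * ((a + 1 + 1) * (1 / 2) ^ (-(a + 1 + 1 + 1)))) * ‖z‖ ^ 3 := by
  refine norm_le_mul_pow_succ_of_norm_deriv_le (k := 2)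
    (f := fun z => (1 + z) ^ (-(a : ℂ)) - 1 + a * z - a * (a + 1) / 2 * z ^ 2)
    (f' := fun z => -a * ((1 + z) ^ (-((a + 1 : ℝ) : ℂ)) - 1 + (a + 1 : ℝ) * z)) (fun z hz => ?_)
    (by simp) (by positivity) (fun w hw => ?_) hz
  · refine ((((hasDerivAt_one_add_cpow_neg a hz).sub_const 1).fun_add
      ((hasDerivAt_id' z).const_mul (a : ℂ))).fun_sub
      (((hasDerivAt_id' z).fun_pow 2).const_mul ((a : ℂ) * (a + 1) / 2))).congr_deriv ?_
    push_cast
    ring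
  · rw [norm_mul, norm_neg, norm_real, Real.norm_of_nonneg ha, mul_assoc]
    gcongr
    exact norm_one_add_cpow_sub_linear_le (by linarith) hw

/-- The phase `(1 + i y) + (1 + i y) ^ (-s) / s - (1 + 1 / s)` at the saddle point. -/
noncomputable def saddlePhase (s y : ℝ) : ℂ := y * I + ((1 + y * I) ^ (-(s : ℂ)) - 1) / s

/-- The linear terms of the phase cancel, which is criticality; the quadratic term is `-(s + 1) y ^
2 / 2` and the cubic Taylor remainder is left. -/
theorem exists_norm_saddlePhase_add_le {s : ℝ} (hs : 0 < s) :
    ∃ C ≥ 0, ∀ y : ℝ, |y| ≤ 1 / 2 →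
      ‖saddlePhase s y + ((s + 1) / 2 * y ^ 2 : ℝ)‖ ≤ C * |y| ^ 3 := by
  refine ⟨(s + 1) * ((s + 1 + 1) * (1 / 2) ^ (-(s + 1 + 1 + 1))), by positivity, fun y hy => ?_⟩
  have hn : ‖(y : ℂ) * I‖ = |y| := by simp
  have h := norm_one_add_cpow_sub_quadratic_le hs.le (z := y * I) (by rwa [hn])
  have hsne : (s : ℂ) ≠ 0 := ofReal_ne_zero.2 hs.ne'
  have e : saddlePhase s y + ((s + 1) / 2 * y ^ 2 : ℝ) = (1 / s : ℝ) *
      ((1 + (y : ℂ) * I) ^ (-(s : ℂ)) - 1 + s * (y * I) - s * (s + 1) / 2 * (y * I) ^ 2) := by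
    rw [saddlePhase, mul_pow, I_sq]
    push_cast
    field_simp
    ring
  rw [e, norm_mul, norm_real, Real.norm_of_nonneg (by positivity)]
  rw [hn] at h
  calc _ ≤ 1 / s * (s * ((s + 1) * ((s + 1 + 1) * (1 / 2) ^ (-(s + 1 + 1 + 1)))) * |y| ^ 3) := by
        gcongr
    _ = _ := by field_simp

theorem pow_le_mul_exp_sq {β : ℝ} (hβ : 0 < β) {v : ℝ} (hv : 0 ≤ v) {k : ℕ} (hk : k ≤ 4) :
    v ^ k ≤ (1 + 2 / β ^ 2) * Real.exp (β * v ^ 2) := by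
  have h1 : v ^ k ≤ 1 + v ^ 4 := by
    rcases le_total v 1 with h | h
    · have := pow_le_one₀ (n := k) hv h
      have : 0 ≤ v ^ 4 := by positivity
      linarith
    · have := pow_le_pow_right₀ h hk
      linarith
  have h2 := Real.quadratic_le_exp_of_nonneg (x := β * v ^ 2) (by positivity)
  have h3 : 1 ≤ Real.exp (β * v ^ 2) := Real.one_le_exp (by positivity)
  have h4 : v ^ 4 ≤ 2 / β ^ 2 * Real.exp (β * v ^ 2) := by
    have h5 : (β * v ^ 2) ^ 2 / 2 ≤ Real.exp (β * v ^ 2) := by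
      have : 0 ≤ β * v ^ 2 := by positivity
      linarith
    calc v ^ 4 = 2 / β ^ 2 * ((β * v ^ 2) ^ 2 / 2) := by field_simp
      _ ≤ _ := by gcongr
  linarith

/-- Comparison of the integrand near the saddle point with a Gaussian. -/
theorem exists_norm_exp_saddlePhase_sub_le {s : ℝ} (hs : 0 < s) :
    ∃ δ > 0, δ ≤ 1 / 2 ∧ ∀ E : ℝ, ∃ C ≥ 0, ∀ l : ℝ, 0 < l → ∀ ε ≤ E, ∀ R : ℂ, ‖R‖ ≤ ε → ∀ y : ℝ, |y| ≤ δ →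
      ‖exp (l * saddlePhase s y + R) - Real.exp (-((s + 1) / 2 * l) * y ^ 2)‖ ≤
        C * ((√l)⁻¹ + ε) * Real.exp (-((s + 1) / 8 * l) * y ^ 2) := by
  obtain ⟨C₃, hC₃, h3⟩ := exists_norm_saddlePhase_add_le hs
  set b := (s + 1) / 2 with hb
  have hb0 : 0 < b := by positivity
  -- Small enough for the cubic error to use up at most half of the decay `b y ^ 2`.
  set δ := min (1 / 2) (b / (2 * (C₃ + 1))) with hδ
  have hδ0 : 0 < δ := by positivity
  have hδb : C₃ * δ ≤ b / 2 := by
    have h1 : δ ≤ b / (2 * (C₃ + 1)) := min_le_right _ _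
    have h2 : δ * (2 * (C₃ + 1)) ≤ b := (le_div_iff₀ (by positivity)).1 h1
    nlinarith
  refine ⟨δ, hδ0, min_le_left _ _, fun E => ?_⟩
  set D := 1 + 2 / (b / 4) ^ 2 with hD
  have hD0 : 1 ≤ D := by rw [hD]; have : 0 ≤ 2 / (b / 4) ^ 2 := by positivity
                         linarith
  refine ⟨(C₃ * D + 1) * Real.exp E, by positivity, fun l hl ε hεE R hR y hy => ?_⟩
  have hε0 : 0 ≤ ε := (norm_nonneg R).trans hR
  have hψ := h3 y (hy.trans (min_le_left _ _))
  have hsq : 0 ≤ y ^ 2 := sq_nonneg y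
  have hcube : C₃ * |y| ^ 3 ≤ b / 2 * y ^ 2 := by
    calc C₃ * |y| ^ 3 = C₃ * |y| * y ^ 2 := by rw [← sq_abs y]; ring
      _ ≤ C₃ * δ * y ^ 2 := by gcongr
      _ ≤ _ := by gcongr
  have hreψ : (saddlePhase s y).re ≤ -(b / 2) * y ^ 2 := by
    have h := (le_abs_self _).trans ((abs_re_le_norm _).trans hψ)
    rw [add_re, ofReal_re] at h
    linarith
  have hu : (l * saddlePhase s y + R).re ≤ -(b / 2 * l) * y ^ 2 + E := by
    rw [add_re, re_ofReal_mul]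
    have h1 := (re_le_norm R).trans hR
    have h2 := mul_le_mul_of_nonneg_left hreψ hl.le
    linarith
  have hE : 0 ≤ E := hε0.trans hεE
  have hv : ((-(b * l) * y ^ 2 : ℝ) : ℂ).re ≤ -(b / 2 * l) * y ^ 2 + E := by
    rw [ofReal_re]
    have : 0 ≤ b * l * y ^ 2 := by positivity
    linarith
  rw [ofReal_exp]
  refine (norm_exp_sub_exp_le hu hv).trans ?_
  have hdiff : ‖l * saddlePhase s y + R - ((-(b * l) * y ^ 2 : ℝ) : ℂ)‖ ≤
      l * (C₃ * |y| ^ 3) + ε := by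
    have e : l * saddlePhase s y + R - ((-(b * l) * y ^ 2 : ℝ) : ℂ) =
        l * (saddlePhase s y + (b * y ^ 2 : ℝ)) + R := by push_cast; ring
    rw [e]
    refine (norm_add_le _ _).trans (add_le_add ?_ hR)
    rw [norm_mul, norm_real, Real.norm_of_nonneg hl.le]
    gcongr
  have hsl : 0 < √l := Real.sqrt_pos.2 hl
  have hll : √l * √l = l := Real.mul_self_sqrt hl.le
  -- A further `b / 4` of the decay absorbs the factor `(√l |y|) ^ 3`; the remaining `b / 4 = (s +
  -- 1) / 8` is the final Gaussian rate.
  have hpow := pow_le_mul_exp_sq (β := b / 4) (by positivity) (v := √l * |y|) (by positivity)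
    (k := 3) (by norm_num)
  have hv2 : b / 4 * (√l * |y|) ^ 2 = b / 4 * l * y ^ 2 := by
    rw [mul_pow, sq_abs, sq, hll]; ring
  rw [hv2, ← hD] at hpow
  have h1 : 1 ≤ Real.exp (b / 4 * l * y ^ 2) := Real.one_le_exp (by positivity)
  have hlead : l * (C₃ * |y| ^ 3) + ε ≤
      (C₃ * D + 1) * ((√l)⁻¹ + ε) * Real.exp (b / 4 * l * y ^ 2) := by
    have e : l * (C₃ * |y| ^ 3) = C₃ * (√l)⁻¹ * (√l * |y|) ^ 3 := by
      rw [mul_pow]; field_simp; rw [sq, hll]; ring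
    rw [e]
    set X := Real.exp (b / 4 * l * y ^ 2)
    have hsl' : 0 < (√l)⁻¹ := inv_pos.2 hsl
    calc _ ≤ C₃ * (√l)⁻¹ * (D * X) + ε * X := by
          refine add_le_add (by gcongr) (le_mul_of_one_le_right hε0 h1)
      _ = (C₃ * D * (√l)⁻¹ + ε) * X := by ring
      _ ≤ _ := by
        gcongr
        have : 0 ≤ C₃ * D * ε := by positivity
        nlinarith
  calc _ ≤ (C₃ * D + 1) * ((√l)⁻¹ + ε) * Real.exp (b / 4 * l * y ^ 2) *
        Real.exp (-(b / 2 * l) * y ^ 2 + E) := by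
        refine mul_le_mul_of_nonneg_right (hdiff.trans hlead) (Real.exp_pos _).le
    _ = (C₃ * D + 1) * ((√l)⁻¹ + ε) *
        (Real.exp (b / 4 * l * y ^ 2) * Real.exp (-(b / 2 * l) * y ^ 2 + E)) := by ring
    _ = _ := by
      rw [← Real.exp_add, show b / 4 * l * y ^ 2 + (-(b / 2 * l) * y ^ 2 + E) =
        E + -((s + 1) / 8 * l) * y ^ 2 by rw [hb]; ring, Real.exp_add]
      ring

/-- Laplace's method at the saddle point, with a bound `η` on the minor arcs. -/
theorem exists_norm_integral_sub_gaussian_le {s : ℝ} (hs : 0 < s) :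
    ∃ δ > 0, δ ≤ 1 / 2 ∧ ∀ E : ℝ, ∃ C ≥ 0, ∀ l : ℝ, 0 < l → ∀ σ : ℝ, 0 < σ → σ ≤ 1 → ∀ ε : ℝ, 0 ≤ ε → ε ≤ E → ∀ η : ℝ, 0 ≤ η →
      ∀ W : ℝ → ℂ, Continuous W →
      (∀ y : ℝ, |y| ≤ δ → ∃ R : ℂ, ‖R‖ ≤ ε ∧ W (σ * y) = exp (l * saddlePhase s y + R)) →
      (∀ θ : ℝ, δ * σ ≤ |θ| → |θ| ≤ Real.pi → ‖W θ‖ ≤ η) →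
      ‖(∫ θ in (-Real.pi)..Real.pi, W θ) - (σ * √(2 * Real.pi / ((s + 1) * l)) : ℝ)‖ ≤
        C * σ * (√l)⁻¹ * ((√l)⁻¹ + ε) + 2 * Real.pi * η := by
  obtain ⟨δ, hδ, hδ2, hE⟩ := exists_norm_exp_saddlePhase_sub_le hs
  refine ⟨δ, hδ, hδ2, fun E => ?_⟩
  obtain ⟨C, hC, hCb⟩ := hE E
  set D := 1 + 2 / ((s + 1) / 8) ^ 2 with hD
  have hD0 : 0 ≤ D := by positivity
  refine ⟨(C + D / δ) * √(8 * Real.pi / (s + 1)), by positivity,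
    fun l hl σ hσ hσ1 ε hε hεE η hη W hW hmaj hmin => ?_⟩
  have hsl : 0 < √l := Real.sqrt_pos.2 hl
  have hll : √l * √l = l := Real.mul_self_sqrt hl.le
  have hpi := Real.pi_pos
  have hδσ : δ * σ ≤ Real.pi := by nlinarith [Real.pi_gt_three]
  have hii : ∀ a b : ℝ, IntervalIntegrable W volume a b := fun a b => hW.intervalIntegrable a b
  have hsplit : (∫ θ in (-Real.pi)..Real.pi, W θ) = (∫ θ in (-Real.pi)..(-(δ * σ)), W θ) +
      (∫ θ in (-(δ * σ))..(δ * σ), W θ) + ∫ θ in (δ * σ)..Real.pi, W θ := by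
    rw [intervalIntegral.integral_add_adjacent_intervals (hii _ _) (hii _ _),
      intervalIntegral.integral_add_adjacent_intervals (hii _ _) (hii _ _)]
  have hδσ0 : 0 < δ * σ := by positivity
  have hmin1 : ‖∫ θ in (-Real.pi)..(-(δ * σ)), W θ‖ ≤ η * Real.pi := by
    refine (intervalIntegral.norm_integral_le_of_norm_le_const (C := η) fun θ hθ => ?_).trans ?_
    · rw [uIoc_of_le (by linarith)] at hθ
      have hneg : θ < 0 := by linarith [hθ.2]
      refine hmin θ ?_ ?_ <;> rw [abs_of_neg hneg] <;> linarith [hθ.1, hθ.2]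
    · gcongr; rw [abs_of_nonneg] <;> linarith
  have hmin2 : ‖∫ θ in (δ * σ)..Real.pi, W θ‖ ≤ η * Real.pi := by
    refine (intervalIntegral.norm_integral_le_of_norm_le_const (C := η) fun θ hθ => ?_).trans ?_
    · rw [uIoc_of_le (by linarith)] at hθ
      have hpos : 0 < θ := by linarith [hθ.1]
      refine hmin θ ?_ ?_ <;> rw [abs_of_pos hpos] <;> linarith [hθ.1, hθ.2]
    · gcongr; rw [abs_of_nonneg] <;> linarith
  set g : ℝ → ℂ := indicator (Ioc (-δ) δ) (fun y => W (σ * y)) with hg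
  have hmid : (∫ θ in (-(δ * σ))..(δ * σ), W θ) = σ * ∫ y, g y := by
    rw [hg, integral_indicator measurableSet_Ioc,
      ← intervalIntegral.integral_of_le (by linarith), ← real_smul,
      intervalIntegral.smul_integral_comp_mul_left]
    congr 1 <;> ring
  have hgint : Integrable g := by
    rw [hg, integrable_indicator_iff measurableSet_Ioc]
    exact ((hW.comp (continuous_const_mul σ)).integrableOn_Icc (a := -δ) (b := δ)).mono_set
      Ioc_subset_Icc_self
  have hGint : Integrable fun y : ℝ => ((Real.exp (-((s + 1) / 2 * l) * y ^ 2) : ℝ) : ℂ) :=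
    (integrable_exp_neg_mul_sq (by positivity)).ofReal
  have hG : ∫ y : ℝ, ((Real.exp (-((s + 1) / 2 * l) * y ^ 2) : ℝ) : ℂ) =
      (√(2 * Real.pi / ((s + 1) * l)) : ℝ) := by
    rw [integral_complex_ofReal, integral_gaussian]
    congr 2; field_simp
  have hpt : ∀ y : ℝ, ‖g y - (Real.exp (-((s + 1) / 2 * l) * y ^ 2) : ℝ)‖ ≤
      (C + D / δ) * ((√l)⁻¹ + ε) * Real.exp (-((s + 1) / 8 * l) * y ^ 2) := by
    intro y
    by_cases hy : y ∈ Ioc (-δ) δ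
    · have hy' : |y| ≤ δ := abs_le.2 ⟨hy.1.le, hy.2⟩
      obtain ⟨R, hR, hWR⟩ := hmaj y hy'
      rw [hg, indicator_of_mem hy, hWR]
      refine (hCb l hl ε hεE R hR y hy').trans ?_
      have : 0 ≤ D / δ := by positivity
      gcongr
      linarith
    · have hy' : δ ≤ |y| := by
        by_contra! h
        exact hy ⟨(abs_lt.1 h).1, (abs_lt.1 h).2.le⟩
      rw [hg, indicator_of_notMem hy, zero_sub, norm_neg, norm_real,
        Real.norm_of_nonneg (Real.exp_pos _).le]
      -- Off the arc, `1 ≤ |y| / δ` converts the Gaussian tail into a factor `1 / √l`, so the same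
      -- pointwise bound holds on the whole line.
      have hpow := pow_le_mul_exp_sq (β := (s + 1) / 8) (by positivity) (v := √l * |y|)
        (by positivity) (k := 1) (by norm_num)
      have hv2 : (s + 1) / 8 * (√l * |y|) ^ 2 = (s + 1) / 8 * l * y ^ 2 := by
        rw [mul_pow, sq_abs, sq, hll]; ring
      rw [hv2, ← hD, pow_one] at hpow
      have h1 : 1 ≤ D / δ * (√l)⁻¹ * Real.exp ((s + 1) / 8 * l * y ^ 2) := by
        calc (1 : ℝ) ≤ |y| / δ := by rwa [le_div_iff₀ hδ, one_mul]
          _ = (√l * |y|) * (√l)⁻¹ / δ := by field_simp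
          _ ≤ (D * Real.exp ((s + 1) / 8 * l * y ^ 2)) * (√l)⁻¹ / δ := by gcongr
          _ = _ := by ring
      have h2 : Real.exp (-((s + 1) / 2 * l) * y ^ 2) ≤
          Real.exp (-((s + 1) / 8 * l) * y ^ 2) * Real.exp (-((s + 1) / 8 * l * y ^ 2)) := by
        rw [← Real.exp_add]
        refine Real.exp_le_exp.2 ?_
        have : 0 ≤ (s + 1) * l * y ^ 2 := by positivity
        linarith
      refine h2.trans ?_
      rw [mul_comm ((C + D / δ) * ((√l)⁻¹ + ε))]
      gcongr
      rw [Real.exp_neg, inv_le_iff_one_le_mul₀ (Real.exp_pos _)]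
      refine h1.trans ?_
      gcongr ?_ * _
      have : 0 ≤ C * ((√l)⁻¹ + ε) + D / δ * ε := by positivity
      nlinarith
  have hdiff : ‖(∫ y, g y) - (√(2 * Real.pi / ((s + 1) * l)) : ℝ)‖ ≤
      (C + D / δ) * ((√l)⁻¹ + ε) * (√(8 * Real.pi / (s + 1)) * (√l)⁻¹) := by
    rw [← hG, ← integral_sub hgint hGint]
    refine (norm_integral_le_of_norm_le
      ((integrable_exp_neg_mul_sq (b := (s + 1) / 8 * l) (by positivity)).const_mul _)
      (Eventually.of_forall hpt)).trans (le_of_eq ?_)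
    rw [integral_const_mul, integral_gaussian]
    congr 1
    rw [← Real.sqrt_inv, ← Real.sqrt_mul (by positivity)]
    congr 1; field_simp
  rw [hsplit, hmid]
  have e : (∫ θ in (-Real.pi)..(-(δ * σ)), W θ) + σ * (∫ y, g y) + (∫ θ in (δ * σ)..Real.pi, W θ) -
      (σ * √(2 * Real.pi / ((s + 1) * l)) : ℝ) =
      σ * ((∫ y, g y) - (√(2 * Real.pi / ((s + 1) * l)) : ℝ)) +
      ((∫ θ in (-Real.pi)..(-(δ * σ)), W θ) + ∫ θ in (δ * σ)..Real.pi, W θ) := by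
    push_cast; ring
  rw [e]
  refine (norm_add_le _ _).trans (add_le_add ?_ ?_)
  · rw [norm_mul, norm_real, Real.norm_of_nonneg hσ.le]
    calc _ ≤ σ * ((C + D / δ) * ((√l)⁻¹ + ε) * (√(8 * Real.pi / (s + 1)) * (√l)⁻¹)) := by gcongr
      _ = _ := by ring
  · refine (norm_add_le _ _).trans ?_
    linarith

/-! ### Saddle parameters and the normalized integral -/

theorem powExpRemLip_nonneg (s : ℂ) : 0 ≤ powExpRemLip s := by
  unfold powExpRemLip
  have : 0 ≤ ∑' n : ℤ, |(n : ℝ)| ^ (-(s.re + 1)) := tsum_nonneg fun n => by positivity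
  positivity

theorem self_le_polylog {s : ℝ} (hs : 0 ≤ s) {x : ℝ} (hx : x ∈ Ioo (0 : ℝ) 1) :
    x ≤ polylog s x := by
  have hx0 := hx.1
  simpa using le_hasSum (hasSum_polylog s hs hx) 0 fun j _ => by positivity

theorem polylog_le {s : ℝ} (hs : 0 ≤ s) {x : ℝ} (hx : x ∈ Ioo (0 : ℝ) 1) :
    polylog s x ≤ x / (1 - x) := by
  have hx0 := hx.1
  refine hasSum_le (fun j => ?_) (hasSum_polylog s hs hx) (hasSum_pow_succ hx)
  refine div_le_self (by positivity) (Real.one_le_rpow ?_ hs)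
  exact_mod_cast Nat.le_add_left 1 j

theorem phaseL_pos {s : ℝ} (hs : 0 < s) {x : ℝ} (hx : x ∈ Ioo (0 : ℝ) 1) : 0 < phaseL s x := by
  have h1 := hx.1.trans_le (self_le_polylog (s := s + 1) (by linarith) hx)
  have h2 := Real.Gamma_pos_of_pos (s := s + 1) (by linarith)
  unfold phaseL
  positivity

theorem phaseL_rpow {s : ℝ} (hs : 0 < s) {x : ℝ} (hx : x ∈ Ioo (0 : ℝ) 1) :
    phaseL s x ^ (s + 1) = Real.Gamma (s + 1) * polylog (s + 1) x := by
  have h1 := hx.1.trans_le (self_le_polylog (s := s + 1) (by linarith) hx)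
  have h2 := Real.Gamma_pos_of_pos (s := s + 1) (by linarith)
  rw [phaseL, ← Real.rpow_mul (by positivity), one_div, inv_mul_cancel₀ (by linarith),
    Real.rpow_one]

/-- The real saddle point `L n ^ (-1 / (s + 1))`. -/
noncomputable def saddle (s : ℝ) (n : ℕ) (x : ℝ) : ℝ := phaseL s x * (n : ℝ) ^ (-(1 / (s + 1)))

/-- The large parameter `L n ^ (s / (s + 1))`. -/
noncomputable def saddleScale (s : ℝ) (n : ℕ) (x : ℝ) : ℝ := phaseL s x * (n : ℝ) ^ (s / (s + 1))

theorem natCast_mul_saddle {s : ℝ} (hs : 0 < s) {n : ℕ} (hn : 0 < n) (x : ℝ) :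
    n * saddle s n x = saddleScale s n x := by
  have hn' : (0 : ℝ) < n := by exact_mod_cast hn
  rw [saddle, saddleScale, mul_left_comm, mul_comm (n : ℝ), ← Real.rpow_add_one hn'.ne']
  congr 2; field_simp; ring

/-- With `natCast_mul_saddle` this is the saddle equation `n σ = Γ(s + 1) Li_{s+1}(x) σ ^ (-s)`; the
exponent at the saddle is therefore `(1 + 1 / s) l`. -/
theorem gamma_mul_polylog_mul_saddle_rpow {s : ℝ} (hs : 0 < s) {n : ℕ} (hn : 0 < n) {x : ℝ}
    (hx : x ∈ Ioo (0 : ℝ) 1) :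
    Real.Gamma (s + 1) * polylog (s + 1) x * saddle s n x ^ (-s) = saddleScale s n x := by
  have hn' : (0 : ℝ) < n := by exact_mod_cast hn
  have hL := phaseL_pos hs hx
  rw [← phaseL_rpow hs hx, saddle, Real.mul_rpow hL.le (by positivity), ← Real.rpow_mul hn'.le,
    ← mul_assoc, ← Real.rpow_add hL, saddleScale]
  congr 1
  · rw [show s + 1 + -s = 1 by ring, Real.rpow_one]
  · congr 1; field_simp

/-- The Cauchy integrand divided by its approximate value at the saddle point. -/
noncomputable def normalizedIntegrand (s : ℝ) (n : ℕ) (x θ : ℝ) : ℂ :=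
  exp (n * (saddle s n x + θ * I) + logGenProduct s x (exp (-(saddle s n x + θ * I))) -
    ((1 + 1 / s) * saddleScale s n x + log (1 - x) * -riemannZeta (1 - s)))

theorem continuous_normalizedIntegrand {s : ℝ} {x : ℝ} (hx : x ∈ Ioo (0 : ℝ) 1)
    {n : ℕ} (hσ : 0 < saddle s n x) : Continuous (normalizedIntegrand s n x) := by
  have h : Continuous fun θ : ℝ => logGenProduct s x (exp (-(saddle s n x + θ * I))) :=
    (differentiableOn_logGenProduct s hx).continuousOn.comp_continuous (by fun_prop) fun θ =>
      mem_ball_zero_iff.2 (norm_exp_neg_lt_one (by simpa using hσ))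
  unfold normalizedIntegrand
  fun_prop

/-- This is the shape the saddle method produces: approximate integrand at the saddle times the
Gaussian integral over `2 π`. The square roots agree because `n ^ ((s + 2) / (s + 1)) σ ^ 2 = L l`.
-/
theorem mainTerm_eq {s : ℝ} (hs : 0 < s) {n : ℕ} (hn : 0 < n) {x : ℝ} (hx : x ∈ Ioo (0 : ℝ) 1) :
    mainTerm s n x = exp ((1 + 1 / s) * saddleScale s n x + log (1 - x) * -riemannZeta (1 - s)) *
      ((1 / (2 * Real.pi) * (saddle s n x *
        √(2 * Real.pi / ((s + 1) * saddleScale s n x))) : ℝ) : ℂ) := by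
  have hn' : (0 : ℝ) < n := by exact_mod_cast hn
  have hL := phaseL_pos hs hx
  have hpi := Real.pi_pos
  have hσ : 0 < saddle s n x := by unfold saddle; positivity
  have hl : 0 < saddleScale s n x := by unfold saddleScale; positivity
  have hne : (1 - (x : ℂ)) ≠ 0 := by
    rw [← ofReal_one, ← ofReal_sub]; exact ofReal_ne_zero.2 (by linarith [hx.2])
  have h1 : √(phaseL s x / (2 * Real.pi * (s + 1) * (n : ℝ) ^ ((s + 2) / (s + 1)))) =
      1 / (2 * Real.pi) * (saddle s n x * √(2 * Real.pi / ((s + 1) * saddleScale s n x))) := by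
    rw [← mul_assoc]
    rw [Real.sqrt_eq_iff_mul_self_eq (by positivity) (by positivity)]
    have e : (n : ℝ) ^ ((s + 2) / (s + 1)) * (saddle s n x) ^ 2 =
        phaseL s x * saddleScale s n x := by
      rw [saddle, saddleScale, mul_pow, ← Real.rpow_natCast ((n : ℝ) ^ _), ← Real.rpow_mul hn'.le,
        mul_left_comm, ← Real.rpow_add hn', sq, mul_assoc]
      congr 3; push_cast; field_simp; ring
    have e2 : 1 / (2 * Real.pi) * saddle s n x * √(2 * Real.pi / ((s + 1) * saddleScale s n x)) *
        (1 / (2 * Real.pi) * saddle s n x * √(2 * Real.pi / ((s + 1) * saddleScale s n x))) =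
        (1 / (2 * Real.pi) * saddle s n x) ^ 2 * (2 * Real.pi / ((s + 1) * saddleScale s n x)) := by
      conv_rhs => rw [← Real.mul_self_sqrt
        (show 0 ≤ 2 * Real.pi / ((s + 1) * saddleScale s n x) by positivity)]
      ring
    rw [e2]
    have hnn : 0 < (n : ℝ) ^ ((s + 2) / (s + 1)) := by positivity
    field_simp
    first | linear_combination e | linear_combination -e
  rw [mainTerm, h1, cpow_def_of_ne_zero hne, exp_add]
  have h2 : (s + 1) / s * (n : ℝ) ^ (s / (s + 1)) * phaseL s x = (1 + 1 / s) * saddleScale s n x := by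
    rw [saddleScale]; field_simp
  rw [h2]
  push_cast
  ring

theorem genCoeff_div_mainTerm {s : ℝ} (hs : 0 < s) {n : ℕ} (hn : 0 < n) {x : ℝ}
    (hx : x ∈ Ioo (0 : ℝ) 1) :
    genCoeff (powerSeq s) n x / mainTerm s n x =
      (∫ θ in (-Real.pi)..Real.pi, normalizedIntegrand s n x θ) /
        ((saddle s n x * √(2 * Real.pi / ((s + 1) * saddleScale s n x)) : ℝ) : ℂ) := by
  have hL := phaseL_pos hs hx
  have hn' : (0 : ℝ) < n := by exact_mod_cast hn
  have hσ : 0 < saddle s n x := by unfold saddle; positivity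
  have hpi : (Real.pi : ℂ) ≠ 0 := ofReal_ne_zero.2 Real.pi_ne_zero
  rw [mainTerm_eq hs hn hx, genCoeff_eq_integral s hx hσ]
  simp only [normalizedIntegrand, exp_sub _ (_ + _ : ℂ), intervalIntegral.integral_div]
  have h0 := exp_ne_zero ((1 + 1 / s) * saddleScale s n x + log (1 - x) * -riemannZeta (1 - s))
  generalize exp ((1 + 1 / s) * saddleScale s n x + log (1 - x) * -riemannZeta (1 - s)) = Z at *
  generalize saddle s n x * √(2 * Real.pi / ((s + 1) * saddleScale s n x)) = Y
  generalize (∫ θ in (-Real.pi)..Real.pi, exp (n * (saddle s n x + θ * I) +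
    logGenProduct s x (exp (-(saddle s n x + θ * I))))) = J
  push_cast
  field_simp

theorem exists_norm_ratio_sub_one_le {s : ℝ} (hs : 0 < s) {b : ℝ} (hb : b < 1) :
    ∃ c > 0, ∃ C ≥ 0, ∀ x ∈ Ioc (0 : ℝ) b, ∀ n : ℕ, 0 < n → saddle s n x ≤ 1 →
      ‖genCoeff (powerSeq s) n x / mainTerm s n x - 1‖ ≤ C * ((√(saddleScale s n x))⁻¹ +
        saddle s n x + (√(saddleScale s n x))⁻¹ * (n * Real.exp (-c * saddleScale s n x))) := by
  by_cases hb0 : b ≤ 0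
  · exact ⟨1, one_pos, 0, le_rfl, fun x hx => absurd (hx.1.trans_le hx.2) (not_lt.2 hb0)⟩
  push Not at hb0
  obtain ⟨δ, hδ, hδ2, hE⟩ := exists_norm_integral_sub_gaussian_le hs
  obtain ⟨c, hc, hcmin⟩ := re_logGenProduct_le hs hδ
  have hG := Real.Gamma_pos_of_pos (s := s + 1) (by linarith)
  have hK := powExpRemLip_nonneg s
  have hb1 : 0 < 1 - b := by linarith
  -- The factor `2` covers `‖τ‖ ≤ 2 σ` on the major arc.
  set κ := 2 * (powExpRemLip s * (b / (1 - b))) with hκ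
  have hκ0 : 0 ≤ κ := by positivity
  obtain ⟨C, hC, hCb⟩ := hE κ
  set c' := c * ((1 - b) / Real.Gamma (s + 1)) with hc'
  set r := √(2 * Real.pi / (s + 1)) with hr
  have hr0 : 0 < r := Real.sqrt_pos.2 (by have := Real.pi_pos; positivity)
  refine ⟨c', by positivity, (C * (1 + κ) + 2 * Real.pi * Real.exp κ) / r,
    by have := Real.pi_pos; positivity, fun x hx n hn hσ1 => ?_⟩
  have hx01 : x ∈ Ioo (0 : ℝ) 1 := ⟨hx.1, hx.2.trans_lt hb⟩
  have hx0 := hx.1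
  have hL := phaseL_pos hs hx01
  have hn' : (0 : ℝ) < n := by exact_mod_cast hn
  set σ := saddle s n x with hσdef
  set l := saddleScale s n x with hldef
  have hσ : 0 < σ := by rw [hσdef]; unfold saddle; positivity
  have hl : 0 < l := by rw [hldef]; unfold saddleScale; positivity
  have hnσ : n * σ = l := natCast_mul_saddle hs hn x
  have hA : Real.Gamma (s + 1) * polylog (s + 1) x * σ ^ (-s) = l :=
    gamma_mul_polylog_mul_saddle_rpow hs hn hx01
  set B := Real.Gamma s * polylog (s + 1) x with hB
  have hsB : B * σ ^ (-s) = l / s := by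
    rw [← hA, Real.Gamma_add_one hs.ne', hB]; field_simp
  have hxb : x / (1 - x) ≤ b / (1 - b) := by
    have := hx.2
    gcongr
  -- the remainder of the expansion on the sector
  set Z := log (1 - (x : ℂ)) * -riemannZeta (1 - s) with hZ
  have hrem : ∀ τ : ℂ, τ ∈ sector → 0 < τ.re → ‖τ‖ ≤ 2 * σ →
      ‖logGenProduct s x (exp (-τ)) - (B * τ ^ (-(s : ℂ)) + Z)‖ ≤ κ * σ := by
    intro τ h1 h2 h3
    refine (norm_logGenProduct_sub_le hs hx01 h1 h2).trans ?_
    calc _ ≤ powExpRemLip s * (b / (1 - b)) * (2 * σ) := by gcongr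
      _ = _ := by rw [hκ]; ring
  have hmaj : ∀ y : ℝ, |y| ≤ δ → ∃ R : ℂ, ‖R‖ ≤ κ * σ ∧
      normalizedIntegrand s n x (σ * y) = exp (l * saddlePhase s y + R) := by
    intro y hy
    have hy2 : |y| ≤ 1 / 2 := hy.trans hδ2
    have hτ : (σ : ℂ) + (σ * y : ℝ) * I = σ * (1 + y * I) := by push_cast; ring
    have hne : 1 + (y : ℂ) * I ≠ 0 := fun h => by
      have := congrArg re h
      simp at this
    have hre : ((σ : ℂ) + (σ * y : ℝ) * I).re = σ := by simp
    have him : ((σ : ℂ) + (σ * y : ℝ) * I).im = σ * y := by simp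
    refine ⟨_, hrem (σ + (σ * y : ℝ) * I) ?_ (by rw [hre]; exact hσ) ?_, ?_⟩
    · change |((σ : ℂ) + (σ * y : ℝ) * I).im| ≤ ((σ : ℂ) + (σ * y : ℝ) * I).re
      rw [hre, him, abs_mul, abs_of_pos hσ]
      nlinarith
    · refine (norm_le_abs_re_add_abs_im _).trans ?_
      rw [hre, him, abs_mul, abs_of_pos hσ]
      nlinarith
    · rw [normalizedIntegrand, ← hσdef, ← hldef, ← hZ]
      congr 1
      have hpow : (B : ℂ) * (σ + (σ * y : ℝ) * I) ^ (-(s : ℂ)) =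
          l / s * (1 + y * I) ^ (-(s : ℂ)) := by
        rw [hτ, ofReal_mul_cpow_of_pos hσ hne, ← ofReal_neg, ← ofReal_cpow hσ.le, ← mul_assoc,
          ← ofReal_mul, hsB, ofReal_div]
      rw [hpow, saddlePhase]
      have hnσ' : (n : ℂ) * σ = l := by exact_mod_cast hnσ
      push_cast
      linear_combination (1 + y * I) * hnσ'
  -- The minor arc saving is measured by `l` uniformly in `x ≤ b`, through `(1 - b) Li_{s+1}(x) ≤
  -- x`.
  have hxl : c' * l ≤ c * x * σ ^ (-s) := by
    rw [← hA, hc']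
    have h1 := polylog_le (s := s + 1) (by linarith) hx01
    have h2 : (1 - b) * polylog (s + 1) x ≤ x := by
      have h3 : (1 - x) * polylog (s + 1) x ≤ x := by
        rw [le_div_iff₀ (by linarith [hx01.2])] at h1; linarith
      have h4 := hx0.trans_le (self_le_polylog (s := s + 1) (by linarith) hx01)
      nlinarith [hx.2]
    calc _ = c * ((1 - b) * polylog (s + 1) x) * σ ^ (-s) := by field_simp
      _ ≤ _ := by gcongr
  have hmin : ∀ θ : ℝ, δ * σ ≤ |θ| → |θ| ≤ Real.pi →
      ‖normalizedIntegrand s n x θ‖ ≤ Real.exp κ * Real.exp (-c' * l) := by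
    intro θ h1 h2
    have h3 := hcmin x hx01 σ ⟨hσ, hσ1⟩ θ h1 h2
    have h4 := hrem σ (ofReal_mem_sector hσ.le) (by simpa using hσ)
      (by rw [norm_real, Real.norm_of_nonneg hσ.le]; linarith)
    have h5 := (re_le_norm _).trans h4
    rw [← ofReal_neg s, ← ofReal_cpow hσ.le, ← ofReal_mul, hsB, sub_re, add_re, ofReal_re] at h5
    rw [normalizedIntegrand, ← hσdef, ← hldef, ← hZ, norm_exp, ← Real.exp_add]
    refine Real.exp_le_exp.2 ?_
    have e1 : ((n : ℂ) * (σ + θ * I)).re = l := by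
      rw [← hnσ, ← ofReal_natCast, re_ofReal_mul]; simp
    have e2 : ((1 + 1 / (s : ℂ)) * l).re = l + l / s := by
      have : (1 + 1 / (s : ℂ)) * l = ((l + l / s : ℝ) : ℂ) := by push_cast; ring
      rw [this, ofReal_re]
    rw [sub_re, add_re, add_re, e1, e2]
    have : κ * σ ≤ κ := by nlinarith
    linarith
  have hmain := hCb l hl σ hσ hσ1 (κ * σ) (by positivity) (by nlinarith)
    (Real.exp κ * Real.exp (-c' * l)) (by positivity) (normalizedIntegrand s n x)
    (continuous_normalizedIntegrand hx01 hσ) hmaj hmin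
  have hsl : 0 < √l := Real.sqrt_pos.2 hl
  have hY : √(2 * Real.pi / ((s + 1) * l)) = r * (√l)⁻¹ := by
    rw [hr, ← Real.sqrt_inv, ← Real.sqrt_mul (by have := Real.pi_pos; positivity)]
    congr 1; field_simp
  have hY0 : 0 < σ * (r * (√l)⁻¹) := by positivity
  rw [hY] at hmain
  rw [genCoeff_div_mainTerm hs hn hx01, ← hσdef, ← hldef, hY, div_sub_one
    (ofReal_ne_zero.2 hY0.ne'), norm_div, norm_real, Real.norm_of_nonneg hY0.le,
    div_le_iff₀ hY0]
  refine hmain.trans ?_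
  have hll : l = √l * √l := (Real.mul_self_sqrt hl.le).symm
  set q := (√l)⁻¹ with hq
  have hq0 : 0 < q := inv_pos.2 hsl
  -- This rewrites the absolute minor arc bound as a multiple of the Gaussian size `σ q`, at the
  -- cost of a factor `n q`.
  have hqn : q * q * (n * σ) = 1 := by
    rw [hnσ, hq]; nth_rewrite 3 [hll]; field_simp
  set e := Real.exp (-c' * l)
  have he : 0 < e := Real.exp_pos _
  have hpi := Real.pi_pos
  have hκe : 0 < Real.exp κ := Real.exp_pos κ
  calc C * σ * q * (q + κ * σ) + 2 * Real.pi * (Real.exp κ * e)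
      = σ * q * (C * q + C * κ * σ + 2 * Real.pi * Real.exp κ * (q * (n * e))) := by
        linear_combination (-(2 * Real.pi * Real.exp κ * e)) * hqn
    _ ≤ σ * q * ((C * (1 + κ) + 2 * Real.pi * Real.exp κ) * (q + σ + q * (n * e))) := by
        gcongr
        have t1 : 0 ≤ C * κ * q := by positivity
        have t2 : 0 ≤ C * σ := by positivity
        have t3 : 0 ≤ C * (1 + κ) * (q * (n * e)) := by positivity
        have t4 : 0 ≤ 2 * Real.pi * Real.exp κ * (q + σ) := by positivity
        linarith
    _ = _ := by field_simp

/-! ### Uniformity on compact sets and the final rate -/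

theorem exists_Icc_of_isCompact_subset_Ioo {X : Set ℝ} (hX : IsCompact X)
    (hX01 : X ⊆ Ioo (0 : ℝ) 1) : ∃ a > 0, ∃ b < 1, X ⊆ Icc a b := by
  rcases X.eq_empty_or_nonempty with rfl | hne
  · exact ⟨1, one_pos, 0, zero_lt_one, empty_subset _⟩
  · obtain ⟨a, ha⟩ := hX.exists_isLeast hne
    obtain ⟨b, hb⟩ := hX.exists_isGreatest hne
    exact ⟨a, (hX01 ha.1).1, b, (hX01 hb.1).2, fun x hx => ⟨ha.2 hx, hb.2 hx⟩⟩

theorem exists_phaseL_bounds {s : ℝ} (hs : 0 < s) {a b : ℝ} (ha : 0 < a) (hb : b < 1) :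
    ∃ m > 0, ∃ M, ∀ x ∈ Icc a b, m ≤ phaseL s x ∧ phaseL s x ≤ M := by
  have hG := Real.Gamma_pos_of_pos (s := s + 1) (by linarith)
  have hs1 : 0 ≤ 1 / (s + 1) := by positivity
  refine ⟨(Real.Gamma (s + 1) * a) ^ (1 / (s + 1)), by positivity,
    (Real.Gamma (s + 1) * (b / (1 - b))) ^ (1 / (s + 1)), fun x hx => ?_⟩
  have hx01 : x ∈ Ioo (0 : ℝ) 1 := ⟨ha.trans_le hx.1, hx.2.trans_lt hb⟩
  have h1 := self_le_polylog (s := s + 1) (by linarith) hx01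
  have h2 := polylog_le (s := s + 1) (by linarith) hx01
  have h3 : x / (1 - x) ≤ b / (1 - b) := by
    have := hx.2
    have := hx01.1
    have : 0 < 1 - b := by linarith
    gcongr
    linarith
  have h4 := hx01.1
  have h5 := hx.1
  unfold phaseL
  constructor
  · gcongr; linarith
  · refine Real.rpow_le_rpow (by have := h4.trans_le h1; positivity) ?_ hs1
    gcongr; linarith

/-- The relative error is `O(n ^ (-s / (2 s + 2)) + n ^ (-1 / (s + 1)))`. -/
theorem exists_eventually_norm_ratio_sub_one_le {s : ℝ} (hs : 0 < s) {X : Set ℝ}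
    (hX : IsCompact X) (hX01 : X ⊆ Ioo (0 : ℝ) 1) :
    ∃ C ≥ 0, ∀ᶠ n : ℕ in atTop, ∀ x ∈ X,
      ‖genCoeff (powerSeq s) n x / mainTerm s n x - 1‖ ≤
        C * ((n : ℝ) ^ (-(s / (2 * s + 2))) + (n : ℝ) ^ (-(1 / (s + 1)))) := by
  obtain ⟨a, ha, b, hb, hXab⟩ := exists_Icc_of_isCompact_subset_Ioo hX hX01
  obtain ⟨m, hm, M, hmM⟩ := exists_phaseL_bounds hs ha hb
  obtain ⟨c, hc, C, hC, hCb⟩ := exists_norm_ratio_sub_one_le hs hb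
  refine ⟨C * (2 * (√m)⁻¹ + |M|), by positivity, ?_⟩
  have hs1 : 0 < 1 / (s + 1) := by positivity
  have hs2 : 0 < s / (s + 1) := by positivity
  have ev1 : ∀ᶠ n : ℕ in atTop, M * (n : ℝ) ^ (-(1 / (s + 1))) < 1 := by
    have := ((tendsto_rpow_neg_atTop hs1).comp tendsto_natCast_atTop_atTop).const_mul M
    rw [mul_zero] at this
    exact this.eventually_lt_const one_pos
  -- The stretched exponential beats `n`, so the minor arc term is eventually absorbed by `1 / √l`.
  have ev2 : ∀ᶠ n : ℕ in atTop, n * Real.exp (-(c * m) * (n : ℝ) ^ (s / (s + 1))) < 1 := by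
    have h := (tendsto_rpow_mul_exp_neg_mul_atTop_nhds_zero ((s + 1) / s) (c * m)
      (by positivity)).comp ((tendsto_rpow_atTop hs2).comp
        (tendsto_natCast_atTop_atTop (R := ℝ)))
    filter_upwards [h.eventually_lt_const one_pos] with n hn
    simp only [Function.comp] at hn
    rwa [← Real.rpow_mul (Nat.cast_nonneg n), show s / (s + 1) * ((s + 1) / s) = 1 by field_simp,
      Real.rpow_one] at hn
  filter_upwards [ev1, ev2, eventually_gt_atTop 0] with n h1 h2 hn x hx
  have hn' : (0 : ℝ) < n := by exact_mod_cast hn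
  have hxab := hXab hx
  obtain ⟨hm1, hM1⟩ := hmM x hxab
  have hσM : saddle s n x ≤ M * (n : ℝ) ^ (-(1 / (s + 1))) := by unfold saddle; gcongr
  have hlm : m * (n : ℝ) ^ (s / (s + 1)) ≤ saddleScale s n x := by unfold saddleScale; gcongr
  have hbound := hCb x ⟨(hX01 hx).1, hxab.2⟩ n hn (by linarith)
  have hq : (√(saddleScale s n x))⁻¹ ≤ (√m)⁻¹ * (n : ℝ) ^ (-(s / (2 * s + 2))) := by
    have e : √(m * (n : ℝ) ^ (s / (s + 1))) = √m * (n : ℝ) ^ (s / (2 * s + 2)) := by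
      rw [Real.sqrt_mul hm.le, Real.sqrt_eq_rpow ((n : ℝ) ^ _), ← Real.rpow_mul hn'.le]
      congr 2; field_simp
    rw [Real.rpow_neg hn'.le, ← mul_inv, ← e]
    exact inv_anti₀ (Real.sqrt_pos.2 (by positivity)) (Real.sqrt_le_sqrt hlm)
  have hne : n * Real.exp (-c * saddleScale s n x) ≤ 1 := by
    refine le_trans (mul_le_mul_of_nonneg_left (Real.exp_le_exp.2 ?_) hn'.le) h2.le
    have := mul_le_mul_of_nonneg_left hlm hc.le
    linarith
  have hMabs : M * (n : ℝ) ^ (-(1 / (s + 1))) ≤ |M| * (n : ℝ) ^ (-(1 / (s + 1))) := by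
    gcongr; exact le_abs_self M
  refine hbound.trans ?_
  rw [mul_assoc C]
  gcongr
  set q := (√(saddleScale s n x))⁻¹
  have hq0 : 0 ≤ q := by positivity
  have hqe : q * (n * Real.exp (-c * saddleScale s n x)) ≤ q := mul_le_of_le_one_right hq0 hne
  have t1 : 0 ≤ (√m)⁻¹ * (n : ℝ) ^ (-(1 / (s + 1))) := by positivity
  have t2 : 0 ≤ |M| * (n : ℝ) ^ (-(s / (2 * s + 2))) := by positivity
  linarith

theorem mainTheorem3 (s₀ : ℝ) (hs₀ : 0 < s₀) (X : Set ℝ) (hX : IsCompact X)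
    (hX01 : X ⊆ Set.Ioo (0 : ℝ) 1) :
    TendstoUniformlyOn
        (fun (n : ℕ) (x : ℝ) => genCoeff (powerSeq s₀) n (x : ℂ) / mainTerm s₀ n x)
        (fun _ => (1 : ℂ)) Filter.atTop X ∧
      ∀ σ₀ ∈ Set.Ioo (-1 : ℝ) 0, ∃ C : ℝ, ∀ᶠ n : ℕ in Filter.atTop, ∀ x ∈ X,
        ‖genCoeff (powerSeq s₀) n (x : ℂ) / mainTerm s₀ n x - 1‖ ≤
          C * (n : ℝ) ^ (-min (-σ₀ / (s₀ + 1)) (s₀ / (2 * s₀ + 2))) := by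
  obtain ⟨C, hC, hCn⟩ := exists_eventually_norm_ratio_sub_one_le hs₀ hX hX01
  constructor
  · rw [Metric.tendstoUniformlyOn_iff]
    intro ε hε
    have h1 := (tendsto_rpow_neg_atTop (y := s₀ / (2 * s₀ + 2)) (by positivity)).comp
      (tendsto_natCast_atTop_atTop (R := ℝ))
    have h2 := (tendsto_rpow_neg_atTop (y := 1 / (s₀ + 1)) (by positivity)).comp
      (tendsto_natCast_atTop_atTop (R := ℝ))
    have h3 := (h1.add h2).const_mul C
    rw [add_zero, mul_zero] at h3
    filter_upwards [hCn, h3.eventually_lt_const hε] with n hn hnε x hx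
    rw [dist_comm, dist_eq_norm]
    exact (hn x hx).trans_lt hnε
  · intro σ₀ hσ₀
    refine ⟨C * 2, ?_⟩
    filter_upwards [hCn, eventually_ge_atTop 1] with n hn hn1 x hx
    refine (hn x hx).trans ?_
    have hn1' : (1 : ℝ) ≤ n := by exact_mod_cast hn1
    have h1 : (n : ℝ) ^ (-(s₀ / (2 * s₀ + 2))) ≤
        (n : ℝ) ^ (-min (-σ₀ / (s₀ + 1)) (s₀ / (2 * s₀ + 2))) :=
      Real.rpow_le_rpow_of_exponent_le hn1' (neg_le_neg (min_le_right _ _))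
    have h2 : (n : ℝ) ^ (-(1 / (s₀ + 1))) ≤
        (n : ℝ) ^ (-min (-σ₀ / (s₀ + 1)) (s₀ / (2 * s₀ + 2))) := by
      -- Here `-σ₀ < 1` enters: the proven exponent `1 / (s₀ + 1)` is better than the required one.
      refine Real.rpow_le_rpow_of_exponent_le hn1' (neg_le_neg ((min_le_left _ _).trans ?_))
      gcongr
      linarith [hσ₀.1]
    rw [mul_assoc]
    gcongr
    linarith
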